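/- Let $n\in\mathbb N$ and let $\mathcal R\subset\mathbb C^n$ be a bounded Reinhardt domain, i.e. a nonempty, bounded, connected open set such that $(z_1,\dots,z_n)\in\mathcal R$ implies $(e^{i\theta_1}z_1,\dots,e^{i\theta_n}z_n)\in\mathcal R$ for all $\theta\in\mathbb R^n$. Let $1<p<\infty$, and let $f\in A^p(\mathcal R)$, i.e. $f$ is holomorphic on $\mathcal R$ and $\|f\|_p=\left(\int_{\mathcal R}|f|^p\,dV\right)^{1/p}<\infty$, where $dV$ is Lebesgue measure. Then there is a unique family of coefficients $(a_\alpha)_{\alpha\in\mathbb Z^n}$ such that $f$ has the Laurent expansion $$f(z)=\sum_{\alpha\in\mathbb Z^n}a_\alpha z^\alpha ,$$ converging (unconditionally and) uniformly on compact subsets of $\mathcal R$, where $a_\alpha=0$ whenever $\alpha_j<0$ for some $j$ for which $\mathcal R$ contains a point with $z_j=0$. For $N\in\mathbb N$ let $$S_Nf(z)=\sum_{|\alpha|_\infty\le N}a_\alpha z^\alpha,\qquad |\alpha|_\infty=\max_{1\le j\le n}|\alpha_j|,$$ be the square partial sums of this expansion. Then $S_Nf\in A^p(\mathcal R)$ for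 every $N$, and $$\|S_Nf-f\|_{p}\longrightarrow 0\qquad\text{as }N\to\infty .$$ -/

import Mathlib

open MeasureTheory Filter Topology
open scoped ENNReal

namespace ReinhardtLaurent

/-- A set in `ℂⁿ` is Reinhardt if it is invariant under all rotations of the coordinates. -/
def IsReinhardt {n : ℕ} (R : Set (Fin n → ℂ)) : Prop :=
  ∀ z ∈ R, ∀ θ : Fin n → ℝ, (fun j => Complex.exp (θ j * Complex.I) * z j) ∈ R

/-- A bounded Reinhardt domain: a nonempty, open, connected, bounded Reinhardt set
(`IsConnected` includes nonemptiness). -/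
structure IsBoundedReinhardtDomain {n : ℕ} (R : Set (Fin n → ℂ)) : Prop where
  isOpen : IsOpen R
  isConnected : IsConnected R
  isBounded : Bornology.IsBounded R
  isReinhardt : IsReinhardt R

/-- `f` belongs to the Bergman space `A^p(R)`: it is holomorphic on `R` and lies in `L^p(R)` with
respect to Lebesgue measure. -/
structure MemBergman {n : ℕ} (R : Set (Fin n → ℂ)) (p : ℝ≥0∞) (f : (Fin n → ℂ) → ℂ) : Prop where
  holomorphic : DifferentiableOn ℂ f R
  memLp : MemLp f p (volume.restrict R)

/-- The monomial `e_α(z) = z₁^{α₁} ⋯ zₙ^{αₙ}` with integer exponents. -/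
noncomputable def laurentMonomial {n : ℕ} (α : Fin n → ℤ) (z : Fin n → ℂ) : ℂ :=
  ∏ j, z j ^ α j

/-- `∑ a_α z^α`, summed over `α ∈ ℤⁿ`, is a Laurent expansion of `f` on `R`: every monomial that
occurs is well defined on `R` (no negative power of a coordinate that vanishes somewhere on `R`),
and the series converges (unconditionally) to `f`, uniformly on every compact subset of `R`. -/
structure IsLaurentExpansion {n : ℕ} (R : Set (Fin n → ℂ)) (f : (Fin n → ℂ) → ℂ)
    (a : (Fin n → ℤ) → ℂ) : Prop where
  wellDefined : ∀ α, a α ≠ 0 → ∀ z ∈ R, ∀ j, α j < 0 → z j ≠ 0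
  hasSum : ∀ K ⊆ R, IsCompact K → HasSumUniformlyOn (fun α z => a α * laurentMonomial α z) f K

/-- The multi-indices `α ∈ ℤⁿ` with `|α|_∞ ≤ N`. -/
noncomputable def squareIndices (n N : ℕ) : Finset (Fin n → ℤ) :=
  Fintype.piFinset fun _ => Finset.Icc (-(N : ℤ)) (N : ℤ)

theorem mem_squareIndices {n N : ℕ} {α : Fin n → ℤ} :
    α ∈ squareIndices n N ↔ ∀ j, |α j| ≤ (N : ℤ) := by
  simp [squareIndices, abs_le]

/-- The square partial sum `∑_{|α|_∞ ≤ N} a_α z^α`. -/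
noncomputable def squarePartialSum {n : ℕ} (a : (Fin n → ℤ) → ℂ) (N : ℕ) (z : Fin n → ℂ) : ℂ :=
  ∑ α ∈ squareIndices n N, a α * laurentMonomial α z

end ReinhardtLaurent

/-!
The torus `𝕋ⁿ` acts on `R` by rotations of the coordinates, and the action preserves Lebesgue
measure. The `α`-th Fourier coefficient of `t ↦ f (t • z)` is holomorphic in `z` and homogeneous of
weight `α` under the action, so near a point off the coordinate hyperplanes it is a multiple of
`z ^ α`, and by the identity theorem it is the same multiple `a α * z ^ α` on all of `R`. Cauchy
estimates at the points `(r ^ sgn αⱼ * zⱼ)ⱼ`, with `r > 1` slightly larger than `1`, gain a factor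
`r ^ (-∑ⱼ |αⱼ|)` and make the Laurent series converge normally.

On each orbit `S_N` is the square truncation of a Fourier series, which is bounded on `L^p(𝕋ⁿ)`
uniformly in `N`, one coordinate at a time, by M. Riesz's theorem on the circle. Integrating over
the orbits carries this bound over to `L^p(R)`, and since `S_N f → f` uniformly on each orbit,
dominated convergence over the orbits gives `S_N f → f` in `L^p(R)`.

Riesz's theorem for `1 < p ≤ 2` comes from the pointwise inequality
`|w| ^ p ≤ A (Re w) ^ p - B Re (w ^ p)` on the right half-plane, applied to a holomorphic function
with positive real part and combined with the mean value property of its `p`-th power; a general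
`F` is half the difference of `K + F` and `K - F`, where `Re K` is slightly larger than `|Re F|` on
the circle. A bound for `p` gives one for `2 p`, by applying it to `-i (F² - F(0)²)`, whose real
part is `2 Re F Im F` when `F(0)` is real.
-/

namespace ReinhardtLaurent

open AddCircle

section Circle

theorem exists_one_le_mul_cos_rpow_sub {p : ℝ} (hp1 : 1 < p) (hp2 : p ≤ 2) :
    ∃ A B : ℝ, 0 ≤ A ∧ 0 ≤ B ∧ ∀ θ : ℝ, |θ| < Real.pi / 2 →
      1 ≤ A * Real.cos θ ^ p - B * Real.cos (θ * p) := by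
  have hp0 : 0 < p := by linarith
  obtain ⟨γ, hγ1, hγ2⟩ : ∃ γ, Real.pi / 2 / p < γ ∧ γ < Real.pi / 2 :=
    exists_between (div_lt_self Real.pi_div_two_pos hp1)
  have hγ0 : 0 < γ := (div_pos Real.pi_div_two_pos hp0).trans hγ1
  rw [div_lt_iff₀ hp0] at hγ1
  have hcos : 0 < Real.cos γ := Real.cos_pos_of_mem_Ioo ⟨by linarith, hγ2⟩
  have hcosp : Real.cos (γ * p) < 0 :=
    Real.cos_neg_of_pi_div_two_lt_of_lt hγ1 (by nlinarith)
  set B : ℝ := (-Real.cos (γ * p))⁻¹ with hB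
  have hB0 : 0 < B := inv_pos.2 (by linarith)
  refine ⟨(1 + B) * (Real.cos γ ^ p)⁻¹, B, by positivity, hB0.le, fun θ hθ => ?_⟩
  have hcosθ : 0 < Real.cos |θ| := Real.cos_pos_of_mem_Ioo ⟨by linarith [abs_nonneg θ], hθ⟩
  rw [← Real.cos_abs θ, ← Real.cos_abs (θ * p), abs_mul, abs_of_pos hp0]
  -- For `|θ| ≤ γ` the power of `cos θ` is bounded below; beyond `γ`, `cos (θ p)` is negative.
  rcases le_total |θ| γ with h | h
  · have hmono : Real.cos γ ^ p ≤ Real.cos |θ| ^ p := Real.rpow_le_rpow hcos.le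
      (Real.cos_le_cos_of_nonneg_of_le_pi (abs_nonneg _) (by linarith) h) hp0.le
    have hmain : 1 + B ≤ (1 + B) * (Real.cos γ ^ p)⁻¹ * Real.cos |θ| ^ p := by
      rw [mul_assoc, ← div_eq_inv_mul]
      exact le_mul_of_one_le_right (by positivity) ((one_le_div (by positivity)).2 hmono)
    linarith [mul_le_of_le_one_right hB0.le (Real.cos_le_one (|θ| * p))]
  · have hmono : Real.cos (|θ| * p) ≤ Real.cos (γ * p) :=
      Real.cos_le_cos_of_nonneg_of_le_pi (by positivity) (by nlinarith) (by gcongr)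
    have hmain : 1 ≤ B * -Real.cos (|θ| * p) := by
      rw [hB, inv_mul_eq_div, one_le_div (by linarith)]
      linarith
    have hpos : 0 ≤ (1 + B) * (Real.cos γ ^ p)⁻¹ * Real.cos |θ| ^ p := by positivity
    linarith

theorem exists_norm_rpow_le_mul_re_rpow_sub {p : ℝ} (hp1 : 1 < p) (hp2 : p ≤ 2) :
    ∃ A B : ℝ, 0 ≤ A ∧ 0 ≤ B ∧ ∀ w : ℂ, 0 < w.re →
      ‖w‖ ^ p ≤ A * w.re ^ p - B * (w ^ (p : ℂ)).re := by
  obtain ⟨A, B, hA, hB, hAB⟩ := exists_one_le_mul_cos_rpow_sub hp1 hp2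
  refine ⟨A, B, hA, hB, fun w hw => ?_⟩
  have harg := Complex.abs_arg_lt_pi_div_two_iff.2 (Or.inl hw)
  have hcos : 0 ≤ Real.cos w.arg := Real.cos_nonneg_of_mem_Icc (abs_le.1 harg.le)
  calc ‖w‖ ^ p ≤ ‖w‖ ^ p * (A * Real.cos w.arg ^ p - B * Real.cos (w.arg * p)) :=
        le_mul_of_one_le_right (by positivity) (hAB _ harg)
    _ = A * w.re ^ p - B * (w ^ (p : ℂ)).re := by
        rw [Complex.cpow_ofReal_re, ← Complex.norm_mul_cos_arg w,
          Real.mul_rpow (norm_nonneg _) hcos]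
        ring

theorem re_pos_of_forall_mem_frontier_re_pos {E : Type*} [NormedAddCommGroup E]
    [NormedSpace ℂ E] [FiniteDimensional ℂ E] [Nontrivial E] {U : Set E} {F : E → ℂ}
    (hU : Bornology.IsBounded U) (hF : DiffContOnCl ℂ F U)
    (hpos : ∀ z ∈ frontier U, 0 < (F z).re) {z : E} (hz : z ∈ closure U) : 0 < (F z).re := by
  obtain ⟨w, hw, hmax⟩ := Complex.exists_mem_frontier_isMaxOn_norm hU
    (closure_nonempty_iff.1 ⟨z, hz⟩)
    (Complex.differentiable_exp.comp_diffContOnCl hF.neg)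
  have hle := hmax hz
  simp only [Set.mem_ofPred_eq, Function.comp_apply, Pi.neg_apply, Complex.norm_exp,
    Complex.neg_re, Real.exp_le_exp, neg_le_neg_iff] at hle
  exact (hpos w hw).trans_le hle

theorem fourier_coe_eq_circleMap (x : ℝ) :
    fourier 1 (x : UnitAddCircle) = circleMap 0 1 (2 * Real.pi * x) := by
  rw [fourier_coe_apply]
  simp [circleMap, mul_right_comm]

/-- The restriction of `F` to the unit circle, parametrised by `ℝ / ℤ`. -/
noncomputable def boundaryValue (F : ℂ → ℂ) (t : UnitAddCircle) : ℂ := F (fourier 1 t)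

theorem continuous_boundaryValue {F : ℂ → ℂ} (hF : DiffContOnCl ℂ F (Metric.ball 0 1)) :
    Continuous (boundaryValue F) :=
  hF.continuousOn_ball.comp_continuous (fourier 1).continuous fun t => by
    simp [fourier_apply, Circle.norm_coe]

theorem integral_boundaryValue {F : ℂ → ℂ} (hF : DiffContOnCl ℂ F (Metric.ball 0 1)) :
    ∫ t, boundaryValue F t ∂haarAddCircle = F 0 := by
  have hmean : Real.circleAverage F 0 1 = F 0 := DiffContOnCl.circleAverage (by simpa using hF)
  have hscale := intervalIntegral.smul_integral_comp_mul_left (a := 0) (b := 1)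
    (fun θ => F (circleMap 0 1 θ)) (2 * Real.pi)
  rw [AddCircle.integral_haarAddCircle, ← UnitAddCircle.intervalIntegral_preimage 0, ← hmean,
    Real.circleAverage_def]
  simp only [boundaryValue, fourier_coe_eq_circleMap]
  simp only [mul_zero, mul_one] at hscale
  rw [← hscale, smul_smul, inv_mul_cancel₀ Real.two_pi_pos.ne']
  simp

theorem exists_fourier_one_eq {z : ℂ} (hz : ‖z‖ = 1) :
    ∃ t : UnitAddCircle, fourier 1 t = z := by
  refine ⟨(z.arg / (2 * Real.pi) : ℝ), ?_⟩
  rw [fourier_coe_eq_circleMap, mul_div_cancel₀ _ Real.two_pi_pos.ne', circleMap]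
  simpa [hz] using Complex.norm_mul_exp_arg_mul_I z

theorem eLpNorm_rpow_eq_ofReal_integral {X E : Type*} [MeasurableSpace X]
    [NormedAddCommGroup E] {μ : Measure X} {p : ℝ} (hp : 0 < p) {f : X → E}
    (hf : MemLp f (ENNReal.ofReal p) μ) :
    eLpNorm f (ENNReal.ofReal p) μ ^ p = ENNReal.ofReal (∫ x, ‖f x‖ ^ p ∂μ) := by
  rw [hf.eLpNorm_eq_integral_rpow_norm (by simpa using hp) ENNReal.ofReal_ne_top,
    ENNReal.toReal_ofReal hp.le, ENNReal.ofReal_rpow_of_nonneg (by positivity) hp.le,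
    ← Real.rpow_mul (by positivity), inv_mul_cancel₀ hp.ne', Real.rpow_one]

theorem eLpNorm_le_ofReal_mul_of_integral_rpow_le {X E F : Type*} [MeasurableSpace X]
    [NormedAddCommGroup E] [NormedAddCommGroup F] {μ : Measure X} {p A : ℝ} (hp : 0 < p)
    (hA : 0 ≤ A) {f : X → E} {g : X → F} (hf : MemLp f (ENNReal.ofReal p) μ)
    (hg : MemLp g (ENNReal.ofReal p) μ)
    (hfg : ∫ x, ‖f x‖ ^ p ∂μ ≤ A * ∫ x, ‖g x‖ ^ p ∂μ) :
    eLpNorm f (ENNReal.ofReal p) μ ≤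
      ENNReal.ofReal (A ^ p⁻¹) * eLpNorm g (ENNReal.ofReal p) μ := by
  rw [← ENNReal.rpow_le_rpow_iff hp, ENNReal.mul_rpow_of_nonneg _ _ hp.le,
    eLpNorm_rpow_eq_ofReal_integral hp hf, eLpNorm_rpow_eq_ofReal_integral hp hg,
    ENNReal.ofReal_rpow_of_nonneg (by positivity) hp.le, ← Real.rpow_mul hA,
    inv_mul_cancel₀ hp.ne', Real.rpow_one, ← ENNReal.ofReal_mul hA]
  exact ENNReal.ofReal_le_ofReal hfg

theorem re_pos_of_boundaryValue_re_pos {F : ℂ → ℂ}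
    (hF : DiffContOnCl ℂ F (Metric.ball 0 1)) (hpos : ∀ t, 0 < (boundaryValue F t).re) {z : ℂ}
    (hz : z ∈ closure (Metric.ball (0 : ℂ) 1)) : 0 < (F z).re := by
  refine re_pos_of_forall_mem_frontier_re_pos Metric.isBounded_ball hF (fun w hw => ?_) hz
  rw [frontier_ball _ one_ne_zero, mem_sphere_zero_iff_norm] at hw
  obtain ⟨t, rfl⟩ := exists_fourier_one_eq hw
  exact hpos t

theorem diffContOnCl_cpow_const {F : ℂ → ℂ} {U : Set ℂ}
    (hF : DiffContOnCl ℂ F U) (hslit : ∀ z ∈ closure U, F z ∈ Complex.slitPlane) (w : ℂ) :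
    DiffContOnCl ℂ (fun z => F z ^ w) U where
  differentiableOn := hF.differentiableOn.cpow (differentiableOn_const w)
    fun z hz => hslit z (subset_closure hz)
  continuousOn := hF.continuousOn.cpow continuousOn_const hslit

theorem integral_re_boundaryValue {F : ℂ → ℂ} (hF : DiffContOnCl ℂ F (Metric.ball 0 1)) :
    ∫ t, (boundaryValue F t).re ∂haarAddCircle = (F 0).re := by
  rw [← integral_boundaryValue hF]
  exact integral_re (𝕜 := ℂ) ((continuous_boundaryValue hF).integrable_of_hasCompactSupport
    (HasCompactSupport.of_compactSpace _))

theorem exists_integral_norm_boundaryValue_rpow_le_of_re_pos {p : ℝ} (hp1 : 1 < p)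
    (hp2 : p ≤ 2) :
    ∃ A : ℝ, 0 ≤ A ∧ ∀ F : ℂ → ℂ, DiffContOnCl ℂ F (Metric.ball 0 1) → (F 0).im = 0 →
      (∀ t, 0 < (boundaryValue F t).re) →
      ∫ t, ‖boundaryValue F t‖ ^ p ∂haarAddCircle ≤
        A * ∫ t, ‖(boundaryValue F t).re‖ ^ p ∂haarAddCircle := by
  obtain ⟨A, B, hA, hB, hAB⟩ := exists_norm_rpow_le_mul_re_rpow_sub hp1 hp2
  refine ⟨A, hA, fun F hF h0 hpos => ?_⟩
  have hpos' := fun z hz => re_pos_of_boundaryValue_re_pos hF hpos (z := z) hz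
  have hFp : DiffContOnCl ℂ (fun z => F z ^ (p : ℂ)) (Metric.ball 0 1) :=
    diffContOnCl_cpow_const hF (fun z hz => Or.inl (hpos' z hz)) p
  have hmean : 0 ≤ ∫ t, (boundaryValue F t ^ (p : ℂ)).re ∂haarAddCircle := by
    refine (le_of_le_of_eq ?_ (integral_re_boundaryValue hFp).symm)
    have hF0 := hpos' 0 (subset_closure (Metric.mem_ball_self one_pos))
    rw [show F 0 = ((F 0).re : ℂ) from Complex.ext rfl h0, ← Complex.ofReal_cpow hF0.le,
      Complex.ofReal_re]
    positivity
  have hc := continuous_boundaryValue hF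
  have hcp : Continuous fun t => boundaryValue F t ^ (p : ℂ) := continuous_boundaryValue hFp
  have hint : ∀ {g : UnitAddCircle → ℝ}, Continuous g → Integrable g haarAddCircle :=
    fun hg => hg.integrable_of_hasCompactSupport (HasCompactSupport.of_compactSpace _)
  have hre : Integrable (fun t => A * ‖(boundaryValue F t).re‖ ^ p) haarAddCircle :=
    hint (by fun_prop (disch := linarith))
  have him : Integrable (fun t => B * (boundaryValue F t ^ (p : ℂ)).re) haarAddCircle :=
    hint (by fun_prop)
  calc ∫ t, ‖boundaryValue F t‖ ^ p ∂haarAddCircle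
      ≤ ∫ t, (A * ‖(boundaryValue F t).re‖ ^ p - B * (boundaryValue F t ^ (p : ℂ)).re)
          ∂haarAddCircle := by
        refine integral_mono (hint (by fun_prop (disch := linarith)))
          (hre.sub him) fun t => ?_
        simpa only [Real.norm_of_nonneg (hpos t).le] using hAB _ (hpos t)
    _ = A * ∫ t, ‖(boundaryValue F t).re‖ ^ p ∂haarAddCircle
          - B * ∫ t, (boundaryValue F t ^ (p : ℂ)).re ∂haarAddCircle := by
        rw [integral_sub hre him, integral_const_mul, integral_const_mul]
    _ ≤ A * ∫ t, ‖(boundaryValue F t).re‖ ^ p ∂haarAddCircle :=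
        sub_le_self _ (mul_nonneg hB hmean)

theorem exists_eLpNorm_boundaryValue_le_of_re_pos {p : ℝ} (hp1 : 1 < p) (hp2 : p ≤ 2) :
    ∃ A : ℝ, ∀ F : ℂ → ℂ, DiffContOnCl ℂ F (Metric.ball 0 1) → (F 0).im = 0 →
      (∀ t, 0 < (boundaryValue F t).re) →
      eLpNorm (boundaryValue F) (ENNReal.ofReal p) haarAddCircle ≤
        ENNReal.ofReal A *
          eLpNorm (fun t => (boundaryValue F t).re) (ENNReal.ofReal p) haarAddCircle := by
  obtain ⟨A, hA, h⟩ := exists_integral_norm_boundaryValue_rpow_le_of_re_pos hp1 hp2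
  refine ⟨A ^ p⁻¹, fun F hF h0 hpos => ?_⟩
  have hc := continuous_boundaryValue hF
  exact eLpNorm_le_ofReal_mul_of_integral_rpow_le (by linarith) hA
    (hc.memLp_of_hasCompactSupport (HasCompactSupport.of_compactSpace _))
    ((Complex.continuous_re.comp hc).memLp_of_hasCompactSupport
      (HasCompactSupport.of_compactSpace _)) (h F hF h0 hpos)

theorem fourier_natCast (n : ℕ) (t : UnitAddCircle) :
    fourier (n : ℤ) t = (fourier 1 t : ℂ) ^ n := by
  simp [fourier_apply, toCircle_nsmul]

/-- The trigonometric polynomial `∑ c_k e^{2πikt}` with coefficients `c`. -/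
noncomputable def trigPoly : (ℤ →₀ ℂ) →ₗ[ℂ] C(UnitAddCircle, ℂ) :=
  Finsupp.linearCombination ℂ (@fourier (1 : ℝ))

theorem trigPoly_single_apply (k : ℤ) (a : ℂ) (t : UnitAddCircle) :
    trigPoly (Finsupp.single k a) t = a * fourier k t := by
  simp [trigPoly]

theorem exists_norm_sub_trigPoly_lt (g : C(UnitAddCircle, ℂ)) {ε : ℝ} (hε : 0 < ε) :
    ∃ c, ‖g - trigPoly c‖ < ε := by
  have hg : g ∈ closure (Submodule.span ℂ (Set.range (@fourier (1 : ℝ))) :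
      Set C(UnitAddCircle, ℂ)) := by
    rw [← Submodule.topologicalClosure_coe, span_fourier_closure_eq_top]
    trivial
  obtain ⟨f, hf, hfg⟩ := Metric.mem_closure_iff.1 hg ε hε
  obtain ⟨c, rfl⟩ := Finsupp.mem_span_range_iff_exists_finsupp.1 hf
  exact ⟨c, by rwa [← dist_eq_norm]⟩

theorem exists_trigPoly_eq_add_conj (c : ℤ →₀ ℂ) :
    ∃ F G : ℂ → ℂ, Differentiable ℂ F ∧ Differentiable ℂ G ∧ G 0 = 0 ∧
      (∀ t, trigPoly (c.filter (0 ≤ ·)) t = boundaryValue F t) ∧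
      ∀ t, trigPoly c t = boundaryValue F t + starRingEnd ℂ (boundaryValue G t) := by
  induction c using Finsupp.induction_linear with
  | zero =>
    exact ⟨0, 0, differentiable_const 0, differentiable_const 0, rfl,
      by simp [Finsupp.filter_zero, boundaryValue], by simp [boundaryValue]⟩
  | add c d hc hd =>
    obtain ⟨F, G, hF, hG, hG0, hcF, hcFG⟩ := hc
    obtain ⟨F', G', hF', hG', hG0', hdF, hdFG⟩ := hd
    refine ⟨F + F', G + G', hF.add hF', hG.add hG', by simp [hG0, hG0'], fun t => ?_,
      fun t => ?_⟩
    · rw [Finsupp.filter_add, map_add, ContinuousMap.add_apply, hcF, hdF]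
      rfl
    · rw [map_add, ContinuousMap.add_apply, hcFG, hdFG]
      simp only [boundaryValue, Pi.add_apply, map_add]
      ring
  | single k a =>
    rcases le_or_gt 0 k with hk | hk
    · lift k to ℕ using hk
      refine ⟨fun z => a * z ^ k, 0, by fun_prop, differentiable_const 0, rfl, fun t => ?_,
        fun t => ?_⟩
      · rw [Finsupp.filter_single_of_pos _ (Int.natCast_nonneg k), trigPoly_single_apply,
          fourier_natCast, boundaryValue]
      · rw [trigPoly_single_apply, fourier_natCast]
        simp [boundaryValue]
    · obtain ⟨n, rfl⟩ : ∃ n : ℕ, k = -n := ⟨k.natAbs, by omega⟩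
      refine ⟨0, fun z => starRingEnd ℂ a * z ^ n, differentiable_const 0, by fun_prop,
        by simp; omega, fun t => ?_, fun t => ?_⟩
      · rw [Finsupp.filter_single_of_neg _ (not_le.2 hk)]
        simp [boundaryValue]
      · rw [trigPoly_single_apply, fourier_neg, fourier_natCast]
        simp [boundaryValue]

theorem exists_differentiable_abs_re_boundaryValue_sub_lt {g : UnitAddCircle → ℝ}
    (hg : Continuous g) {ε : ℝ} (hε : 0 < ε) :
    ∃ K : ℂ → ℂ, Differentiable ℂ K ∧ (K 0).im = 0 ∧
      ∀ t, |g t - (boundaryValue K t).re| < ε := by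
  obtain ⟨c, hc⟩ := exists_norm_sub_trigPoly_lt ⟨fun t => (g t : ℂ), by fun_prop⟩ hε
  obtain ⟨F, G, hF, hG, -, -, hFG⟩ := exists_trigPoly_eq_add_conj c
  refine ⟨fun z => F z + G z - (F 0 + G 0).im * Complex.I, by fun_prop, by simp, fun t => ?_⟩
  refine lt_of_le_of_lt ?_ ((ContinuousMap.norm_lt_iff _ hε).1 hc t)
  rw [ContinuousMap.sub_apply, hFG]
  refine le_of_eq_of_le ?_ (Complex.abs_re_le_norm _)
  simp [boundaryValue]

/-- M. Riesz's conjugate function inequality with exponent `p` and constant `A`, for the disc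
algebra and normalised by `Im F(0) = 0`. -/
def ConjugateBound (p A : ℝ≥0∞) : Prop :=
  ∀ F : ℂ → ℂ, DiffContOnCl ℂ F (Metric.ball 0 1) → (F 0).im = 0 →
    eLpNorm (boundaryValue F) p haarAddCircle ≤
      A * eLpNorm (fun t => (boundaryValue F t).re) p haarAddCircle

theorem exists_abs_re_boundaryValue_lt_re_boundaryValue {F : ℂ → ℂ} {p : ℝ≥0∞}
    (hp : 1 ≤ p) (hF : DiffContOnCl ℂ F (Metric.ball 0 1)) {ε : ℝ} (hε : 0 < ε) :
    ∃ K : ℂ → ℂ, DiffContOnCl ℂ K (Metric.ball 0 1) ∧ (K 0).im = 0 ∧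
      (∀ t, |(boundaryValue F t).re| < (boundaryValue K t).re) ∧
      eLpNorm (fun t => (boundaryValue K t).re) p haarAddCircle ≤
        eLpNorm (fun t => (boundaryValue F t).re) p haarAddCircle + ENNReal.ofReal ε := by
  have hc := continuous_boundaryValue hF
  obtain ⟨K, hK, hK0, hKε⟩ := exists_differentiable_abs_re_boundaryValue_sub_lt
    (g := fun t => |(boundaryValue F t).re| + ε / 2) (by fun_prop) (half_pos hε)
  have hlt : ∀ t, |(boundaryValue F t).re| < (boundaryValue K t).re := fun t => by
    linarith [(abs_lt.1 (hKε t)).2]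
  refine ⟨K, hK.diffContOnCl, hK0, hlt, ?_⟩
  calc eLpNorm (fun t => (boundaryValue K t).re) p haarAddCircle
      ≤ eLpNorm (fun t => |(boundaryValue F t).re| + ε) p haarAddCircle := by
        refine eLpNorm_mono_real fun t => ?_
        rw [Real.norm_of_nonneg ((abs_nonneg _).trans (hlt t).le)]
        linarith [(abs_lt.1 (hKε t)).1]
    _ ≤ eLpNorm (fun t => |(boundaryValue F t).re|) p haarAddCircle
          + eLpNorm (fun _ => ε) p haarAddCircle :=
        eLpNorm_add_le (Continuous.aestronglyMeasurable (by fun_prop))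
          aestronglyMeasurable_const hp
    _ = eLpNorm (fun t => (boundaryValue F t).re) p haarAddCircle + ENNReal.ofReal ε := by
        congr 1
        · exact eLpNorm_norm (fun t => (boundaryValue F t).re)
        · rw [eLpNorm_const _ (zero_lt_one.trans_le hp).ne' (NeZero.ne _), measure_univ,
            ENNReal.one_rpow, mul_one, Real.enorm_eq_ofReal hε.le]

theorem eLpNorm_inv_two_smul_add_le {X E : Type*} [MeasurableSpace X] [NormedAddCommGroup E]
    [NormedSpace ℝ E] {μ : Measure X} {p B : ℝ≥0∞} (hp : 1 ≤ p) {f g : X → E}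
    (hf : AEStronglyMeasurable f μ) (hg : AEStronglyMeasurable g μ) (hfB : eLpNorm f p μ ≤ B)
    (hgB : eLpNorm g p μ ≤ B) : eLpNorm ((2⁻¹ : ℝ) • (f + g)) p μ ≤ B := by
  rw [eLpNorm_const_smul, Real.enorm_eq_ofReal (by positivity),
    ENNReal.ofReal_inv_of_pos zero_lt_two, ENNReal.ofReal_ofNat]
  calc 2⁻¹ * eLpNorm (f + g) p μ ≤ 2⁻¹ * (B + B) := by
        gcongr
        exact (eLpNorm_add_le hf hg hp).trans (add_le_add hfB hgB)
    _ = B := by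
        rw [← two_mul, ← mul_assoc, ENNReal.inv_mul_cancel two_ne_zero ENNReal.ofNat_ne_top,
          one_mul]

theorem eLpNorm_boundaryValue_le_of_abs_re_lt {F K : ℂ → ℂ} {p A : ℝ≥0∞} (hp : 1 ≤ p)
    (hA : ∀ H : ℂ → ℂ, DiffContOnCl ℂ H (Metric.ball 0 1) → (H 0).im = 0 →
      (∀ t, 0 < (boundaryValue H t).re) → eLpNorm (boundaryValue H) p haarAddCircle ≤
        A * eLpNorm (fun t => (boundaryValue H t).re) p haarAddCircle)
    (hF : DiffContOnCl ℂ F (Metric.ball 0 1)) (hF0 : (F 0).im = 0)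
    (hK : DiffContOnCl ℂ K (Metric.ball 0 1)) (hK0 : (K 0).im = 0)
    (hFK : ∀ t, |(boundaryValue F t).re| < (boundaryValue K t).re) :
    eLpNorm (boundaryValue F) p haarAddCircle ≤
      A * (eLpNorm (fun t => (boundaryValue K t).re) p haarAddCircle +
        eLpNorm (fun t => (boundaryValue F t).re) p haarAddCircle) := by
  have hcF := continuous_boundaryValue hF
  have hcK := continuous_boundaryValue hK
  have hreK : AEStronglyMeasurable (fun t => (boundaryValue K t).re) haarAddCircle :=
    Continuous.aestronglyMeasurable (by fun_prop)
  have hreF : AEStronglyMeasurable (fun t => (boundaryValue F t).re) haarAddCircle :=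
    Continuous.aestronglyMeasurable (by fun_prop)
  set M := eLpNorm (fun t => (boundaryValue K t).re) p haarAddCircle +
    eLpNorm (fun t => (boundaryValue F t).re) p haarAddCircle
  have hadd : eLpNorm (boundaryValue K + boundaryValue F) p haarAddCircle ≤ A * M := by
    refine (hA (K + F) (hK.add hF) (by simp [hK0, hF0]) fun t => ?_).trans ?_
    · change 0 < (boundaryValue K t).re + (boundaryValue F t).re
      linarith [(abs_lt.1 (hFK t)).1]
    · gcongr
      exact eLpNorm_add_le hreK hreF hp
  have hsub : eLpNorm (boundaryValue K - boundaryValue F) p haarAddCircle ≤ A * M := by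
    refine (hA (K - F) (hK.sub hF) (by simp [hK0, hF0]) fun t => ?_).trans ?_
    · change 0 < (boundaryValue K t).re - (boundaryValue F t).re
      linarith [(abs_lt.1 (hFK t)).2]
    · gcongr
      exact eLpNorm_sub_le hreK hreF hp
  have hdecomp : boundaryValue F = (2⁻¹ : ℝ) • ((boundaryValue K + boundaryValue F) +
      (boundaryValue F - boundaryValue K)) := by
    rw [add_comm (boundaryValue K), add_add_sub_cancel, ← two_smul ℝ, smul_smul,
      inv_mul_cancel₀ two_ne_zero, one_smul]
  rw [hdecomp]
  exact eLpNorm_inv_two_smul_add_le hp (hcK.add hcF).aestronglyMeasurable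
    (hcF.sub hcK).aestronglyMeasurable hadd ((eLpNorm_sub_comm _ _ _ _).trans_le hsub)

theorem exists_conjugateBound_of_le_two {p : ℝ≥0∞} (hp1 : 1 < p) (hp2 : p ≤ 2) :
    ∃ A ≠ ∞, ConjugateBound p A := by
  have hptop : p ≠ ∞ := (hp2.trans_lt ENNReal.ofNat_lt_top).ne
  obtain ⟨A, hA⟩ := exists_eLpNorm_boundaryValue_le_of_re_pos (p := p.toReal)
    (by simpa using ENNReal.toReal_strict_mono hptop hp1)
    (by simpa using ENNReal.toReal_mono ENNReal.ofNat_ne_top hp2)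
  rw [ENNReal.ofReal_toReal hptop] at hA
  refine ⟨ENNReal.ofReal A * 2, by finiteness, fun F hF hF0 => ?_⟩
  set N := eLpNorm (fun t => (boundaryValue F t).re) p haarAddCircle
  have hbound : ∀ ε : ℝ, 0 < ε → eLpNorm (boundaryValue F) p haarAddCircle ≤
      ENNReal.ofReal A * (N + ENNReal.ofReal ε + N) := fun ε hε => by
    obtain ⟨K, hK, hK0, hFK, hKN⟩ :=
      exists_abs_re_boundaryValue_lt_re_boundaryValue hp1.le hF hε
    refine (eLpNorm_boundaryValue_le_of_abs_re_lt hp1.le hA hF hF0 hK hK0 hFK).trans ?_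
    gcongr
  have hlim : Tendsto (fun ε : ℝ => ENNReal.ofReal A * (N + ENNReal.ofReal ε + N)) (𝓝[>] 0)
      (𝓝 (ENNReal.ofReal A * (N + ENNReal.ofReal 0 + N))) := by
    refine ENNReal.Tendsto.const_mul (Tendsto.add (Tendsto.const_add _ ?_) tendsto_const_nhds)
      (Or.inr ENNReal.ofReal_ne_top)
    exact ENNReal.continuous_ofReal.continuousAt.tendsto.mono_left nhdsWithin_le_nhds
  refine (ge_of_tendsto hlim (eventually_nhdsWithin_of_forall hbound)).trans_eq ?_
  rw [ENNReal.ofReal_zero, add_zero, ← two_mul, mul_assoc]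

theorem eLpNorm_sq {X 𝕜 : Type*} [MeasurableSpace X] [NormedDivisionRing 𝕜] (f : X → 𝕜)
    (p : ℝ≥0∞) (μ : Measure X) : eLpNorm (f ^ 2) p μ = eLpNorm f (2 * p) μ ^ 2 := by
  have h := eLpNorm_norm_rpow (p := p) (μ := μ) f zero_lt_two
  rw [ENNReal.ofReal_ofNat, ENNReal.rpow_ofNat, mul_comm p] at h
  rw [← h]
  exact eLpNorm_congr_norm_ae (Eventually.of_forall fun x => by simp)

theorem enorm_integral_le_eLpNorm {X E : Type*} [MeasurableSpace X] [NormedAddCommGroup E]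
    [NormedSpace ℝ E] {μ : Measure X} [IsProbabilityMeasure μ] {p : ℝ≥0∞} (hp : 1 ≤ p)
    {f : X → E} (hf : AEStronglyMeasurable f μ) : ‖∫ x, f x ∂μ‖ₑ ≤ eLpNorm f p μ := by
  refine (enorm_integral_le_lintegral_enorm f).trans ?_
  rw [← eLpNorm_one_eq_lintegral_enorm]
  exact eLpNorm_le_eLpNorm_of_exponent_le hp hf

theorem enorm_apply_zero_le_eLpNorm_re {F : ℂ → ℂ} {p : ℝ≥0∞} (hp : 1 ≤ p)
    (hF : DiffContOnCl ℂ F (Metric.ball 0 1)) (hF0 : (F 0).im = 0) :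
    ‖F 0‖ₑ ≤ eLpNorm (fun t => (boundaryValue F t).re) p haarAddCircle := by
  rw [show F 0 = ((F 0).re : ℂ) from Complex.ext rfl hF0, ← integral_re_boundaryValue hF]
  exact (enorm_eq_iff_norm_eq.2 (Complex.norm_real _)).trans_le (enorm_integral_le_eLpNorm hp
    (Complex.continuous_re.comp (continuous_boundaryValue hF)).aestronglyMeasurable)

theorem ConjugateBound.eLpNorm_sq_sub_le {p A : ℝ≥0∞} (h : ConjugateBound p A) {F : ℂ → ℂ}
    (hF : DiffContOnCl ℂ F (Metric.ball 0 1)) (hF0 : (F 0).im = 0) :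
    eLpNorm (fun t => boundaryValue F t ^ 2 - F 0 ^ 2) p haarAddCircle ≤
      A * (2 * eLpNorm (fun t => (boundaryValue F t).re) (2 * p) haarAddCircle *
        eLpNorm (boundaryValue F) (2 * p) haarAddCircle) := by
  have hc := continuous_boundaryValue hF
  have hG := h (-Complex.I • (F ^ 2 - fun _ => F 0 ^ 2))
    (((differentiable_id.pow 2).comp_diffContOnCl hF).sub_const (F 0 ^ 2) |>.const_smul _)
    (by simp)
  have hre : ∀ t, (boundaryValue (-Complex.I • (F ^ 2 - fun _ => F 0 ^ 2)) t).re =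
      2 * (boundaryValue F t).re * (boundaryValue F t).im := fun t => by
    simp [boundaryValue, sq, hF0]
    ring
  have : ENNReal.HolderTriple (2 * p) (2 * p) p := ⟨by
    rw [ENNReal.mul_inv (Or.inl two_ne_zero) (Or.inl ENNReal.ofNat_ne_top), ← add_mul,
      ENNReal.inv_two_add_inv_two, one_mul]⟩
  calc eLpNorm (fun t => boundaryValue F t ^ 2 - F 0 ^ 2) p haarAddCircle
      = eLpNorm (boundaryValue (-Complex.I • (F ^ 2 - fun _ => F 0 ^ 2))) p haarAddCircle :=
        eLpNorm_congr_norm_ae (Eventually.of_forall fun t => by simp [boundaryValue])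
    _ ≤ A * eLpNorm (fun t => 2 * (boundaryValue F t).re * (boundaryValue F t).im) p
          haarAddCircle := by simpa only [hre] using hG
    _ ≤ _ := by
        gcongr
        refine eLpNorm_le_eLpNorm_mul_eLpNorm'_of_norm (c := 2)
          (Complex.continuous_re.comp hc).aestronglyMeasurable hc.aestronglyMeasurable
          (fun x w => 2 * x * w.im) (Eventually.of_forall fun t => ?_)
        rw [norm_mul, norm_mul, Real.norm_ofNat]
        gcongr
        · rfl
        · exact Complex.abs_im_le_norm _

theorem ConjugateBound.double {p A : ℝ≥0∞} (hp : 1 ≤ p) (h : ConjugateBound p A) :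
    ConjugateBound (2 * p) (1 + 2 * A) := by
  intro F hF hF0
  have hc := continuous_boundaryValue hF
  set X := eLpNorm (boundaryValue F) (2 * p) haarAddCircle
  set U := eLpNorm (fun t => (boundaryValue F t).re) (2 * p) haarAddCircle
  have hX : X ≠ ∞ :=
    (hc.memLp_of_hasCompactSupport (HasCompactSupport.of_compactSpace _)).eLpNorm_ne_top
  have hUX : U ≤ X := eLpNorm_mono fun t => Complex.abs_re_le_norm _
  have hF0U : ‖F 0‖ₑ ≤ U := enorm_apply_zero_le_eLpNorm_re (by
    exact hp.trans (le_mul_of_one_le_left' one_le_two)) hF hF0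
  have hsq : X * X ≤ (1 + 2 * A) * U * X := by
    calc X * X = eLpNorm (boundaryValue F ^ 2) p haarAddCircle := by rw [eLpNorm_sq, sq]
      _ = eLpNorm ((fun t => boundaryValue F t ^ 2 - F 0 ^ 2) + fun _ => F 0 ^ 2) p
            haarAddCircle := by congr 1; ext t; simp
      _ ≤ A * (2 * U * X) + ‖F 0‖ₑ ^ 2 := by
          refine (eLpNorm_add_le (Continuous.aestronglyMeasurable (by fun_prop))
            aestronglyMeasurable_const hp).trans (add_le_add (h.eLpNorm_sq_sub_le hF hF0) ?_)
          rw [eLpNorm_const _ (zero_lt_one.trans_le hp).ne' (NeZero.ne _), measure_univ,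
            ENNReal.one_rpow, mul_one, enorm_pow]
      _ ≤ A * (2 * U * X) + U * X := by
          rw [sq]
          gcongr
          exact hF0U.trans hUX
      _ = (1 + 2 * A) * U * X := by ring
  rcases eq_or_ne X 0 with h0 | h0
  · exact h0.trans_le zero_le
  · exact (ENNReal.mul_le_mul_iff_left h0 hX).1 hsq

theorem exists_conjugateBound_of_le_two_pow (k : ℕ) :
    ∀ p : ℝ≥0∞, 1 < p → p ≤ 2 ^ (k + 1) → ∃ A ≠ ∞, ConjugateBound p A := by
  induction k with
  | zero => exact fun p hp1 hp => exists_conjugateBound_of_le_two hp1 (by simpa using hp)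
  | succ k ih =>
    intro p hp1 hp
    rcases le_or_gt p 2 with hp2 | hp2
    · exact exists_conjugateBound_of_le_two hp1 hp2
    · have hhalf : 1 < p / 2 := by
        rwa [ENNReal.lt_div_iff_mul_lt (by simp) (by simp), one_mul]
      obtain ⟨A, hA, h⟩ := ih (p / 2) hhalf (ENNReal.div_le_of_le_mul hp)
      refine ⟨1 + 2 * A, by finiteness, ?_⟩
      simpa only [ENNReal.mul_div_cancel two_ne_zero ENNReal.ofNat_ne_top] using
        h.double hhalf.le

theorem exists_conjugateBound {p : ℝ≥0∞} (hp1 : 1 < p) (hp : p ≠ ∞) :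
    ∃ A ≠ ∞, ConjugateBound p A := by
  obtain ⟨k, hk⟩ := ENNReal.exists_nat_gt hp
  refine exists_conjugateBound_of_le_two_pow k p hp1 (hk.le.trans ?_)
  exact_mod_cast (Nat.lt_two_pow_self (n := k + 1)).le.trans' k.le_succ

theorem ConjugateBound.eLpNorm_boundaryValue_le {p A : ℝ≥0∞} (hp : 1 ≤ p)
    (h : ConjugateBound p A) {F : ℂ → ℂ} (hF : DiffContOnCl ℂ F (Metric.ball 0 1)) :
    eLpNorm (boundaryValue F) p haarAddCircle ≤
      A * eLpNorm (fun t => (boundaryValue F t).re) p haarAddCircle + ‖(F 0).im‖ₑ := by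
  set a : ℂ := (F 0).im * Complex.I with ha
  have hFa := h (fun z => F z - a) (hF.sub_const a) (by simp [ha])
  have hca := continuous_boundaryValue (hF.sub_const a)
  calc eLpNorm (boundaryValue F) p haarAddCircle
      = eLpNorm (boundaryValue (fun z => F z - a) + fun _ => a) p haarAddCircle := by
        congr 1
        ext t
        simp [boundaryValue]
    _ ≤ eLpNorm (boundaryValue fun z => F z - a) p haarAddCircle + ‖a‖ₑ := by
        refine (eLpNorm_add_le hca.aestronglyMeasurable aestronglyMeasurable_const hp).trans_eq ?_
        rw [eLpNorm_const a (zero_lt_one.trans_le hp).ne' (NeZero.ne _), measure_univ,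
          ENNReal.one_rpow, mul_one]
    _ ≤ _ := by
        refine add_le_add (by simpa [boundaryValue, ha] using hFa) (enorm_le_iff_norm_le.2 ?_)
        simp [ha]

theorem integral_trigPoly_eq {c : ℤ →₀ ℂ} {F G : ℂ → ℂ}
    (hF : DiffContOnCl ℂ F (Metric.ball 0 1)) (hG : DiffContOnCl ℂ G (Metric.ball 0 1))
    (hFG : ∀ t, trigPoly c t = boundaryValue F t + starRingEnd ℂ (boundaryValue G t)) :
    ∫ t, trigPoly c t ∂haarAddCircle = F 0 + starRingEnd ℂ (G 0) := by
  have hint : ∀ {g : UnitAddCircle → ℂ}, Continuous g → Integrable g haarAddCircle :=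
    fun hg => hg.integrable_of_hasCompactSupport (HasCompactSupport.of_compactSpace _)
  have hcG := continuous_boundaryValue hG
  simp only [hFG]
  rw [integral_add (hint (continuous_boundaryValue hF)) (hint (by fun_prop)), integral_conj,
    integral_boundaryValue hF, integral_boundaryValue hG]

theorem enorm_apply_zero_le_eLpNorm_trigPoly {c : ℤ →₀ ℂ} {p : ℝ≥0∞} (hp : 1 ≤ p)
    {F G : ℂ → ℂ} (hF : DiffContOnCl ℂ F (Metric.ball 0 1))
    (hG : DiffContOnCl ℂ G (Metric.ball 0 1)) (hG0 : G 0 = 0)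
    (hFG : ∀ t, trigPoly c t = boundaryValue F t + starRingEnd ℂ (boundaryValue G t)) :
    ‖F 0‖ₑ ≤ eLpNorm (trigPoly c) p haarAddCircle := by
  have hmean := integral_trigPoly_eq hF hG hFG
  rw [hG0, map_zero, add_zero] at hmean
  rw [← hmean]
  exact enorm_integral_le_eLpNorm hp (trigPoly c).continuous.aestronglyMeasurable

theorem ConjugateBound.eLpNorm_trigPoly_filter_nonneg_le {p A : ℝ≥0∞} (hp : 1 ≤ p)
    (h : ConjugateBound p A) (c : ℤ →₀ ℂ) :
    eLpNorm (trigPoly (c.filter (0 ≤ ·))) p haarAddCircle ≤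
      (A + 1) * eLpNorm (trigPoly c) p haarAddCircle := by
  obtain ⟨F, G, hF, hG, hG0, hcF, hcFG⟩ := exists_trigPoly_eq_add_conj c
  set X := eLpNorm (trigPoly c) p haarAddCircle
  have hbound : ∀ H : ℂ → ℂ, Differentiable ℂ H → ‖H 0‖ ≤ ‖F 0‖ →
      (∀ t, |(boundaryValue H t).re| ≤ ‖trigPoly c t‖) →
      eLpNorm (boundaryValue H) p haarAddCircle ≤ (A + 1) * X := fun H hH hH0 hHc => by
    refine (h.eLpNorm_boundaryValue_le hp hH.diffContOnCl).trans ?_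
    rw [add_mul, one_mul]
    gcongr
    · exact eLpNorm_mono hHc
    · exact (enorm_le_iff_norm_le.2 ((Complex.abs_im_le_norm _).trans hH0)).trans
        (enorm_apply_zero_le_eLpNorm_trigPoly hp hF.diffContOnCl hG.diffContOnCl hG0 hcFG)
  -- `Re (F + G)` and `Re (-i (F - G))` are the real and imaginary parts of the polynomial.
  have hadd := hbound (F + G) (hF.add hG) (by simp [hG0]) fun t => by
    refine le_of_eq_of_le ?_ (Complex.abs_re_le_norm _)
    simp [hcFG, boundaryValue]
  have hsub := hbound (-Complex.I • (F - G)) ((hF.sub hG).const_smul _) (by simp [hG0])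
    fun t => by
      refine le_of_eq_of_le ?_ (Complex.abs_im_le_norm _)
      simp [hcFG, boundaryValue, sub_eq_add_neg]
  have hdecomp : ⇑(trigPoly (c.filter (0 ≤ ·))) = (2⁻¹ : ℝ) • (boundaryValue (F + G) +
      Complex.I • boundaryValue (-Complex.I • (F - G))) := by
    ext t
    simp only [hcF, boundaryValue, Pi.smul_apply, Pi.add_apply, Pi.sub_apply, smul_eq_mul,
      Complex.real_smul, Complex.ofReal_inv, Complex.ofReal_ofNat]
    linear_combination (2⁻¹ * (F (fourier 1 t) - G (fourier 1 t))) * Complex.I_sq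
  rw [hdecomp]
  refine eLpNorm_inv_two_smul_add_le hp
    (continuous_boundaryValue (hF.add hG).diffContOnCl).aestronglyMeasurable
    ((continuous_boundaryValue
      ((hF.sub hG).const_smul _).diffContOnCl).const_smul _).aestronglyMeasurable hadd ?_
  rwa [eLpNorm_const_smul, show ‖Complex.I‖ₑ = 1 by simp [← ofReal_norm], one_mul]

theorem trigPoly_eq_fourier_mul_mapDomain_sub (m : ℤ) (c : ℤ →₀ ℂ) (t : UnitAddCircle) :
    trigPoly c t = fourier m t * trigPoly (c.mapDomain (· - m)) t := by
  induction c using Finsupp.induction_linear with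
  | zero => simp
  | add c d hc hd =>
    rw [Finsupp.mapDomain_add, map_add, map_add, ContinuousMap.add_apply,
      ContinuousMap.add_apply, mul_add, hc, hd]
  | single k a =>
    rw [Finsupp.mapDomain_single, trigPoly_single_apply, trigPoly_single_apply,
      mul_left_comm, ← fourier_add, add_sub_cancel]

theorem mapDomain_sub_filter_nonneg (m : ℤ) (c : ℤ →₀ ℂ) :
    (c.mapDomain (· - m)).filter (0 ≤ ·) = (c.filter (m ≤ ·)).mapDomain (· - m) := by
  induction c using Finsupp.induction_linear with
  | zero => simp [Finsupp.filter_zero]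
  | add c d hc hd =>
    simp only [Finsupp.mapDomain_add, Finsupp.filter_add, hc, hd]
  | single k a =>
    by_cases hk : m ≤ k
    · rw [Finsupp.mapDomain_single, Finsupp.filter_single_of_pos _ (by simpa using hk),
        Finsupp.filter_single_of_pos _ hk, Finsupp.mapDomain_single]
    · rw [Finsupp.mapDomain_single, Finsupp.filter_single_of_neg _ (by simpa using hk),
        Finsupp.filter_single_of_neg _ hk, Finsupp.mapDomain_zero]

theorem eLpNorm_trigPoly_mapDomain_sub (m : ℤ) (c : ℤ →₀ ℂ) (p : ℝ≥0∞) :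
    eLpNorm (trigPoly (c.mapDomain (· - m))) p haarAddCircle =
      eLpNorm (trigPoly c) p haarAddCircle :=
  eLpNorm_congr_norm_ae (Eventually.of_forall fun t => by
    rw [trigPoly_eq_fourier_mul_mapDomain_sub m c, norm_mul, fourier_apply, Circle.norm_coe,
      one_mul])

theorem ConjugateBound.eLpNorm_trigPoly_filter_le {p A : ℝ≥0∞} (hp : 1 ≤ p)
    (h : ConjugateBound p A) (m : ℤ) (c : ℤ →₀ ℂ) :
    eLpNorm (trigPoly (c.filter (m ≤ ·))) p haarAddCircle ≤
      (A + 1) * eLpNorm (trigPoly c) p haarAddCircle := by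
  rw [← eLpNorm_trigPoly_mapDomain_sub m (c.filter _), ← mapDomain_sub_filter_nonneg,
    ← eLpNorm_trigPoly_mapDomain_sub m c]
  exact h.eLpNorm_trigPoly_filter_nonneg_le hp _

theorem exists_eLpNorm_trigPoly_filter_abs_le {p : ℝ≥0∞} (hp1 : 1 < p) (hp : p ≠ ∞) :
    ∃ C ≠ ∞, ∀ (N : ℕ) (c : ℤ →₀ ℂ),
      eLpNorm (trigPoly (c.filter (|·| ≤ (N : ℤ)))) p haarAddCircle ≤
        C * eLpNorm (trigPoly c) p haarAddCircle := by
  obtain ⟨A, hA, h⟩ := exists_conjugateBound hp1 hp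
  refine ⟨(A + 1) + (A + 1), by finiteness, fun N c => ?_⟩
  have hfilter : c.filter (|·| ≤ (N : ℤ)) =
      c.filter (-(N : ℤ) ≤ ·) - c.filter ((N : ℤ) + 1 ≤ ·) := by
    ext k
    simp only [Finsupp.filter_apply, Finsupp.sub_apply, abs_le]
    split_ifs <;> first | omega | simp
  rw [hfilter, map_sub, ContinuousMap.coe_sub, add_mul]
  exact (eLpNorm_sub_le (ContinuousMap.continuous _).aestronglyMeasurable
    (ContinuousMap.continuous _).aestronglyMeasurable hp1.le).trans
    (add_le_add (h.eLpNorm_trigPoly_filter_le hp1.le _ c)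
      (h.eLpNorm_trigPoly_filter_le hp1.le _ c))

theorem exists_eLpNorm_sum_fourier_filter_abs_le {p : ℝ≥0∞} (hp1 : 1 < p) (hp : p ≠ ∞) :
    ∃ C ≠ ∞, ∀ {ι : Type*} (s : Finset ι) (k : ι → ℤ) (c : ι → ℂ) (N : ℕ),
      eLpNorm (fun t : UnitAddCircle => ∑ i ∈ s with |k i| ≤ (N : ℤ), c i * fourier (k i) t) p
          haarAddCircle ≤
        C * eLpNorm (fun t : UnitAddCircle => ∑ i ∈ s, c i * fourier (k i) t) p haarAddCircle := by
  obtain ⟨C, hC, h⟩ := exists_eLpNorm_trigPoly_filter_abs_le hp1 hp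
  refine ⟨C, hC, fun s k c N => ?_⟩
  have hsum : ∀ u : Finset _, (fun t : UnitAddCircle => ∑ i ∈ u, c i * fourier (k i) t) =
      trigPoly (∑ i ∈ u, Finsupp.single (k i) (c i)) := fun u => by
    ext t
    simp [trigPoly_single_apply]
  have hfilter : (∑ i ∈ s, Finsupp.single (k i) (c i)).filter (|·| ≤ (N : ℤ)) =
      ∑ i ∈ s with |k i| ≤ (N : ℤ), Finsupp.single (k i) (c i) := by
    rw [Finsupp.filter_sum, Finset.sum_filter]
    refine Finset.sum_congr rfl fun i _ => ?_
    split_ifs with hi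
    · exact Finsupp.filter_single_of_pos _ hi
    · exact Finsupp.filter_single_of_neg _ hi
  rw [hsum, hsum, ← hfilter]
  exact h N _

end Circle

section Transference

variable {S X E : Type*} [MeasurableSpace S] [MeasurableSpace X] [NormedAddCommGroup E]
  {ν : Measure S} {μ : Measure X} {T : S → X → X} {p : ℝ≥0∞}

theorem eLpNorm_rpow_eq_lintegral (h0 : p ≠ 0) (hp : p ≠ ∞) (g : X → E) :
    eLpNorm g p μ ^ p.toReal = ∫⁻ x, ‖g x‖ₑ ^ p.toReal ∂μ := by
  rw [eLpNorm_eq_lintegral_rpow_enorm_toReal h0 hp, ← ENNReal.rpow_mul,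
    one_div_mul_cancel (ENNReal.toReal_pos h0 hp).ne', ENNReal.rpow_one]

variable [SFinite ν] [SFinite μ]

theorem aemeasurable_eLpNorm_orbit_rpow
    (hT : MeasurePreserving (Function.uncurry T) (ν.prod μ) μ) (h0 : p ≠ 0) (hp : p ≠ ∞)
    {g : X → E} (hg : AEStronglyMeasurable g μ) :
    AEMeasurable (fun x => eLpNorm (fun s => g (T s x)) p ν ^ p.toReal) μ := by
  simp only [eLpNorm_rpow_eq_lintegral h0 hp]
  exact ((hg.comp_measurePreserving hT).enorm.pow_const p.toReal).lintegral_prod_left'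

theorem lintegral_eLpNorm_orbit_rpow
    (hT : MeasurePreserving (Function.uncurry T) (ν.prod μ) μ) (h0 : p ≠ 0) (hp : p ≠ ∞)
    {g : X → E} (hg : AEStronglyMeasurable g μ) :
    ∫⁻ x, eLpNorm (fun s => g (T s x)) p ν ^ p.toReal ∂μ = eLpNorm g p μ ^ p.toReal := by
  simp only [← eLpNorm_comp_measurePreserving hg hT, eLpNorm_rpow_eq_lintegral h0 hp]
  exact (lintegral_prod_symm _ ((hg.comp_measurePreserving hT).enorm.pow_const _)).symm

theorem lintegral_mul_eLpNorm_orbit_rpow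
    (hT : MeasurePreserving (Function.uncurry T) (ν.prod μ) μ) (h0 : p ≠ 0) (hp : p ≠ ∞)
    {g : X → E} (hg : AEStronglyMeasurable g μ) (C : ℝ≥0∞) :
    ∫⁻ x, (C * eLpNorm (fun s => g (T s x)) p ν) ^ p.toReal ∂μ =
      (C * eLpNorm g p μ) ^ p.toReal := by
  simp only [ENNReal.mul_rpow_of_nonneg _ _ ENNReal.toReal_nonneg]
  rw [lintegral_const_mul'' _ (aemeasurable_eLpNorm_orbit_rpow hT h0 hp hg),
    lintegral_eLpNorm_orbit_rpow hT h0 hp hg]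

theorem eLpNorm_le_mul_of_ae_orbit
    (hT : MeasurePreserving (Function.uncurry T) (ν.prod μ) μ) (h0 : p ≠ 0) (hp : p ≠ ∞)
    {g h : X → E} (hg : AEStronglyMeasurable g μ) (hh : AEStronglyMeasurable h μ) {C : ℝ≥0∞}
    (hC : ∀ᵐ x ∂μ, eLpNorm (fun s => g (T s x)) p ν ≤ C * eLpNorm (fun s => h (T s x)) p ν) :
    eLpNorm g p μ ≤ C * eLpNorm h p μ := by
  rw [← ENNReal.rpow_le_rpow_iff (ENNReal.toReal_pos h0 hp),
    ← lintegral_eLpNorm_orbit_rpow hT h0 hp hg, ← lintegral_mul_eLpNorm_orbit_rpow hT h0 hp hh]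
  exact lintegral_mono_ae (hC.mono fun x hx => ENNReal.rpow_le_rpow hx ENNReal.toReal_nonneg)

theorem tendsto_eLpNorm_zero_of_ae_orbit
    (hT : MeasurePreserving (Function.uncurry T) (ν.prod μ) μ) (h0 : p ≠ 0) (hp : p ≠ ∞)
    {g : ℕ → X → E} {h : X → E} (hg : ∀ k, AEStronglyMeasurable (g k) μ) (hh : MemLp h p μ)
    {C : ℝ≥0∞} (hCtop : C ≠ ∞)
    (hC : ∀ k, ∀ᵐ x ∂μ,
      eLpNorm (fun s => g k (T s x)) p ν ≤ C * eLpNorm (fun s => h (T s x)) p ν)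
    (hlim : ∀ᵐ x ∂μ, Tendsto (fun k => eLpNorm (fun s => g k (T s x)) p ν) atTop (𝓝 0)) :
    Tendsto (fun k => eLpNorm (g k) p μ) atTop (𝓝 0) := by
  have hp0 := ENNReal.toReal_pos h0 hp
  have hrpow : ∀ {u : ℕ → ℝ≥0∞} {r : ℝ}, 0 < r → Tendsto u atTop (𝓝 0) →
      Tendsto (fun k => u k ^ r) atTop (𝓝 0) := fun {u r} hr hu => by
    simpa only [ENNReal.zero_rpow_of_pos hr] using hu.ennrpow_const r
  have hbound : ∫⁻ x, (C * eLpNorm (fun s => h (T s x)) p ν) ^ p.toReal ∂μ ≠ ∞ := by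
    rw [lintegral_mul_eLpNorm_orbit_rpow hT h0 hp hh.1]
    exact ENNReal.rpow_ne_top_of_nonneg hp0.le (ENNReal.mul_ne_top hCtop hh.eLpNorm_ne_top)
  have hdom := tendsto_lintegral_of_dominated_convergence' _
    (fun k => aemeasurable_eLpNorm_orbit_rpow hT h0 hp (hg k))
    (fun k => (hC k).mono fun x hx => ENNReal.rpow_le_rpow hx hp0.le) hbound
    (hlim.mono fun x hx => hrpow hp0 hx)
  simp only [lintegral_eLpNorm_orbit_rpow hT h0 hp (hg _), lintegral_zero] at hdom
  simpa only [ENNReal.rpow_rpow_inv hp0.ne'] using hrpow (inv_pos.2 hp0) hdom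

theorem measurePreserving_uncurry {ν : Measure S} [IsProbabilityMeasure ν]
    (hT : Measurable (Function.uncurry T)) (h : ∀ s, MeasurePreserving (T s) μ μ) :
    MeasurePreserving (Function.uncurry T) (ν.prod μ) μ :=
  measurePreserving_snd.comp
    ((MeasurePreserving.id ν).skew_product hT (ae_of_all _ fun s => (h s).map_eq))

end Transference

open UnitAddTorus

section Torus

variable {d : Type*} [Fintype d]

/-- The normalized Haar measure of the torus, as a product of normalized Haar measures. -/
noncomputable abbrev torusHaar (d : Type*) [Fintype d] : Measure (UnitAddTorus d) :=
  Measure.pi fun _ => haarAddCircle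

theorem mFourier_apply_add (α : d → ℤ) (s t : UnitAddTorus d) :
    (mFourier α (s + t) : ℂ) = mFourier α s * mFourier α t := by
  simp [mFourier, fourier_apply, toCircle_add, Finset.prod_mul_distrib]

theorem mFourier_apply_single [DecidableEq d] (α : d → ℤ) (j : d) (s : UnitAddCircle) :
    (mFourier α (Pi.single j s) : ℂ) = fourier (α j) s := by
  simp only [mFourier, ContinuousMap.coe_mk]
  rw [Finset.prod_eq_single j (fun i _ hi => by rw [Pi.single_eq_of_ne hi, fourier_eval_zero])
    (by simp), Pi.single_eq_same]

theorem norm_mFourier_apply (α : d → ℤ) (t : UnitAddTorus d) : ‖(mFourier α t : ℂ)‖ = 1 := by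
  simp only [mFourier, ContinuousMap.coe_mk, fourier_apply, norm_prod, Circle.norm_coe,
    Finset.prod_const_one]

theorem exists_eLpNorm_sum_mFourier_filter_coord_le {p : ℝ≥0∞} (hp1 : 1 < p) (hp : p ≠ ∞)
    (j : d) : ∃ C ≠ ∞, ∀ (s : Finset (d → ℤ)) (c : (d → ℤ) → ℂ) (N : ℕ),
      eLpNorm (fun t => ∑ α ∈ s with |α j| ≤ (N : ℤ), c α * mFourier α t) p (torusHaar d) ≤
        C * eLpNorm (fun t => ∑ α ∈ s, c α * mFourier α t) p (torusHaar d) := by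
  classical
  obtain ⟨C, hC, h⟩ := exists_eLpNorm_sum_fourier_filter_abs_le hp1 hp
  refine ⟨C, hC, fun s c N => ?_⟩
  have hT : MeasurePreserving
      (Function.uncurry fun (x : UnitAddCircle) (t : UnitAddTorus d) => Pi.single j x + t)
      (haarAddCircle.prod (torusHaar d)) (torusHaar d) :=
    measurePreserving_uncurry (Continuous.measurable <|
      ((continuous_single (A := fun _ => UnitAddCircle) j).comp continuous_fst).add continuous_snd)
      fun x => measurePreserving_add_left (torusHaar d) (Pi.single j x)
  refine eLpNorm_le_mul_of_ae_orbit hT (zero_lt_one.trans hp1).ne' hp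
    (Continuous.aestronglyMeasurable (by fun_prop))
    (Continuous.aestronglyMeasurable (by fun_prop)) (ae_of_all _ fun t => ?_)
  simpa only [mFourier_apply_add, mFourier_apply_single, mul_assoc, mul_comm (fourier _ _ : ℂ)]
    using h s (fun α => α j) (fun α => c α * mFourier α t) N

theorem exists_eLpNorm_sum_mFourier_filter_coords_le [DecidableEq d] {p : ℝ≥0∞} (hp1 : 1 < p)
    (hp : p ≠ ∞) (J : Finset d) : ∃ C ≠ ∞, ∀ (s : Finset (d → ℤ)) (c : (d → ℤ) → ℂ) (N : ℕ),
      eLpNorm (fun t => ∑ α ∈ s with ∀ j ∈ J, |α j| ≤ (N : ℤ), c α * mFourier α t) p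
          (torusHaar d) ≤
        C * eLpNorm (fun t => ∑ α ∈ s, c α * mFourier α t) p (torusHaar d) := by
  induction J using Finset.induction_on with
  | empty => exact ⟨1, ENNReal.one_ne_top, by simp⟩
  | insert j J _ ih =>
    obtain ⟨C, hC, h⟩ := ih
    obtain ⟨C', hC', h'⟩ := exists_eLpNorm_sum_mFourier_filter_coord_le hp1 hp j
    refine ⟨C' * C, by finiteness, fun s c N => ?_⟩
    have hfilter : s.filter (fun α => ∀ i ∈ insert j J, |α i| ≤ (N : ℤ)) =
        (s.filter fun α => ∀ i ∈ J, |α i| ≤ (N : ℤ)).filter fun α => |α j| ≤ (N : ℤ) := by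
      ext α
      simp only [Finset.mem_filter, Finset.forall_mem_insert]
      tauto
    rw [hfilter, mul_assoc]
    exact (h' _ c N).trans (by gcongr; exact h s c N)

theorem exists_eLpNorm_sum_mFourier_filter_abs_le {p : ℝ≥0∞} (hp1 : 1 < p) (hp : p ≠ ∞) :
    ∃ C ≠ ∞, ∀ (s : Finset (d → ℤ)) (c : (d → ℤ) → ℂ) (N : ℕ),
      eLpNorm (fun t => ∑ α ∈ s with ∀ j, |α j| ≤ (N : ℤ), c α * mFourier α t) p
          (torusHaar d) ≤
        C * eLpNorm (fun t => ∑ α ∈ s, c α * mFourier α t) p (torusHaar d) := by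
  classical
  simpa using exists_eLpNorm_sum_mFourier_filter_coords_le hp1 hp (Finset.univ : Finset d)

end Torus

section Holomorphic

theorem aestronglyMeasurable_fderiv {𝕜 X ι G : Type*} [NontriviallyNormedField 𝕜]
    [MeasurableSpace X] {μ : Measure X} [Finite ι] [NormedAddCommGroup G] [NormedSpace 𝕜 G]
    {F : X → (ι → 𝕜) → G} {z : ι → 𝕜}
    (hmeas : ∀ᶠ w in 𝓝 z, AEStronglyMeasurable (fun x => F x w) μ)
    (hdiff : ∀ x, DifferentiableAt 𝕜 (F x) z) :
    AEStronglyMeasurable (fun x => fderiv 𝕜 (F x) z) μ := by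
  classical
  cases nonempty_fintype ι
  have happly : ∀ v, AEStronglyMeasurable (fun x => fderiv 𝕜 (F x) z v) μ := fun v => by
    have hline : Tendsto (fun t : 𝕜 => z + t • v) (𝓝[≠] 0) (𝓝 z) := by
      have hcont : Continuous fun t : 𝕜 => z + t • v := by fun_prop
      simpa using (hcont.tendsto 0).mono_left nhdsWithin_le_nhds
    obtain ⟨t, ht, htmeas⟩ := exists_seq_forall_of_frequently (hline.eventually hmeas).frequently
    exact aestronglyMeasurable_of_tendsto_ae atTop
      (fun k => ((htmeas k).sub hmeas.self_of_nhds).const_smul (t k)⁻¹)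
      (ae_of_all _ fun x =>
        ((hdiff x).hasFDerivAt.hasLineDerivAt v).tendsto_slope_zero.comp ht)
  have hsum : ∀ L : (ι → 𝕜) →L[𝕜] G,
      L = ∑ i, (ContinuousLinearMap.proj i).smulRight (L (Pi.single i 1)) := fun L => by
    ext v
    conv_lhs => rw [← Finset.univ_sum_single v, map_sum]
    refine (Finset.sum_congr rfl fun i _ => ?_).trans (sum_apply _ _ _).symm
    simp [← map_smul, ← Pi.single_smul]
  rw [show (fun x => fderiv 𝕜 (F x) z) = _ from funext fun x => hsum _]
  refine Finset.aestronglyMeasurable_fun_sum _ fun i _ => ?_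
  exact (ContinuousLinearMap.smulRightL 𝕜 (ι → 𝕜) G
    (ContinuousLinearMap.proj i)).continuous.comp_aestronglyMeasurable (happly _)

theorem norm_fderiv_le_of_forall_norm_le {E G : Type*} [NormedAddCommGroup E] [NormedSpace ℂ E]
    [NormedAddCommGroup G] [NormedSpace ℂ G] {f : E → G} {z : E} {r M : ℝ} (hr : 0 < r)
    (hf : DifferentiableOn ℂ f (Metric.ball z r)) (hM : ∀ w ∈ Metric.ball z r, ‖f w‖ ≤ M) :
    ‖fderiv ℂ f z‖ ≤ 2 * M / r := by
  refine Complex.norm_fderiv_le_div_of_mapsTo_ball hf (fun w hw => ?_) hr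
  rw [mem_closedBall_iff_norm, two_mul]
  exact (norm_sub_le _ _).trans (add_le_add (hM w hw) (hM z (Metric.mem_ball_self hr)))

theorem differentiableOn_integral {X ι G : Type*} [MeasurableSpace X] {μ : Measure X}
    [IsFiniteMeasure μ] [Finite ι] [NormedAddCommGroup G] [NormedSpace ℂ G]
    {F : X → (ι → ℂ) → G} {U : Set (ι → ℂ)} (hU : IsOpen U)
    (hmeas : ∀ z ∈ U, AEStronglyMeasurable (fun x => F x z) μ)
    (hdiff : ∀ x, DifferentiableOn ℂ (F x) U)
    (hbound : ∀ z ∈ U, ∃ M : ℝ, ∀ᶠ w in 𝓝 z, ∀ x, ‖F x w‖ ≤ M) :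
    DifferentiableOn ℂ (fun z => ∫ x, F x z ∂μ) U := by
  cases nonempty_fintype ι
  intro z hz
  have hmeas_near : ∀ᶠ w in 𝓝 z, AEStronglyMeasurable (fun x => F x w) μ :=
    (hU.eventually_mem hz).mono hmeas
  obtain ⟨M, hM⟩ := hbound z hz
  obtain ⟨r, hr, hball⟩ := Metric.eventually_nhds_iff_ball.1 ((hU.eventually_mem hz).and hM)
  have hsub : ∀ w ∈ Metric.ball z (r / 2), Metric.ball w (r / 2) ⊆ Metric.ball z r :=
    fun w hw => Metric.ball_subset_ball' (by linarith [Metric.mem_ball.1 hw])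
  have hfderiv := hasFDerivAt_integral_of_dominated_of_fderiv_le
    (F := fun w x => F x w) (F' := fun w x => fderiv ℂ (F x) w)
    (bound := fun _ => 2 * M / (r / 2)) (Metric.ball_mem_nhds z (half_pos hr)) hmeas_near
    ((integrable_const M).mono' hmeas_near.self_of_nhds (ae_of_all _ hM.self_of_nhds))
    (aestronglyMeasurable_fderiv hmeas_near fun x => (hdiff x).differentiableAt (hU.mem_nhds hz))
    (ae_of_all _ fun x w hw => norm_fderiv_le_of_forall_norm_le (half_pos hr)
      ((hdiff x).mono fun y hy => (hball y (hsub w hw hy)).1)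
      fun y hy => (hball y (hsub w hw hy)).2 x)
    (integrable_const _)
    (ae_of_all _ fun x w hw => ((hdiff x).differentiableAt (hU.mem_nhds
      (hball w (hsub w hw (Metric.mem_ball_self (half_pos hr)))).1)).hasFDerivAt)
  exact hfderiv.differentiableAt.differentiableWithinAt

theorem eqOn_zero_of_preconnected_of_eventuallyEq_zero {E G : Type*} [NormedAddCommGroup E]
    [NormedSpace ℂ E] [NormedAddCommGroup G] [NormedSpace ℂ G] [CompleteSpace G] {g : E → G}
    {U : Set E} (hg : DifferentiableOn ℂ g U) (hU : IsOpen U) (hUc : IsPreconnected U) {z₀ : E}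
    (hz₀ : z₀ ∈ U) (h0 : ∀ᶠ z in 𝓝 z₀, g z = 0) : Set.EqOn g 0 U := by
  suffices hsub : U ⊆ {z | ∀ᶠ y in 𝓝 z, g y = 0} from fun z hz => (hsub hz).self_of_nhds
  refine hUc.subset_of_closure_inter_subset isOpen_setOfPred_eventually_nhds ⟨z₀, hz₀, h0⟩ ?_
  rintro z ⟨hzc, hzU⟩
  obtain ⟨ε, hε, hball⟩ := Metric.isOpen_iff.1 hU z hzU
  obtain ⟨w, hw, hwz⟩ := Metric.mem_closure_iff.1 hzc ε hε
  filter_upwards [Metric.ball_mem_nhds z hε] with y hy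
  set L : ℂ → E := fun m => w + m • (y - w) with hL
  have hLd : Differentiable ℂ L := by fun_prop
  have hconv : Convex ℝ (L ⁻¹' Metric.ball z ε) :=
    ((convex_ball z ε).translate_preimage_right w).linear_preimage
      ((LinearMap.toSpanSingleton ℂ E (y - w)).restrictScalars ℝ)
  have hL0 : L 0 = w := by simp [hL]
  have hL1 : L 1 = y := by simp [hL]
  have hana : AnalyticOnNhd ℂ (g ∘ L) (L ⁻¹' Metric.ball z ε) :=
    (hg.comp hLd.differentiableOn fun m hm => hball hm).analyticOnNhd
      (Metric.isOpen_ball.preimage hLd.continuous)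
  have hnear : g ∘ L =ᶠ[𝓝 0] 0 := by
    refine hLd.continuous.continuousAt.eventually (p := fun y => g y = 0) ?_
    rwa [hL0]
  simpa [hL1] using hana.eqOn_zero_of_preconnected_of_eventuallyEq_zero hconv.isPreconnected
    (by simpa [hL0, dist_comm] using hwz) hnear (x := 1) (by simpa [hL1] using hy)

end Holomorphic

variable {n : ℕ}

/-- Rotation of the coordinates of `z` by the angles `2πt`. -/
noncomputable def rot (t : UnitAddTorus (Fin n)) (z : Fin n → ℂ) : Fin n → ℂ :=
  fun j => fourier 1 (t j) * z j

@[fun_prop]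
theorem continuous_uncurry_rot :
    Continuous (Function.uncurry (rot : UnitAddTorus (Fin n) → (Fin n → ℂ) → Fin n → ℂ)) := by
  unfold Function.uncurry rot
  fun_prop

theorem rot_add (s t : UnitAddTorus (Fin n)) (z : Fin n → ℂ) :
    rot (s + t) z = rot s (rot t z) := by
  ext j
  simp only [rot, Pi.add_apply, fourier_one, toCircle_add, Circle.coe_mul, mul_assoc]

@[simp]
theorem rot_zero (z : Fin n → ℂ) : rot 0 z = z := by
  ext j
  simp [rot]

theorem rot_single_apply (j : Fin n) (s : UnitAddCircle) (z : Fin n → ℂ) :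
    rot (Pi.single j s) z = Function.update z j (fourier 1 s * z j) := by
  ext i
  rcases eq_or_ne i j with rfl | hij
  · simp [rot]
  · simp [rot, hij]

theorem IsReinhardt.rot_mem {R : Set (Fin n → ℂ)} (hR : IsReinhardt R)
    (t : UnitAddTorus (Fin n)) {z : Fin n → ℂ} (hz : z ∈ R) : rot t z ∈ R := by
  choose x hx using fun j => QuotientAddGroup.mk_surjective (t j)
  convert hR z hz fun j => 2 * Real.pi * x j using 1
  ext j
  simp only [rot, ← hx]
  rw [fourier_coe_apply]
  push_cast
  congr 2
  ring

theorem IsReinhardt.rot_preimage {R : Set (Fin n → ℂ)} (hR : IsReinhardt R)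
    (t : UnitAddTorus (Fin n)) : rot t ⁻¹' R = R :=
  Set.Subset.antisymm (fun z hz => by simpa [← rot_add] using hR.rot_mem (-t) hz)
    fun _ => hR.rot_mem t

theorem laurentMonomial_rot (α : Fin n → ℤ) (t : UnitAddTorus (Fin n)) (z : Fin n → ℂ) :
    laurentMonomial α (rot t z) = mFourier α t * laurentMonomial α z := by
  simp [laurentMonomial, rot, mul_zpow, Finset.prod_mul_distrib, mFourier, fourier_apply,
    toCircle_zsmul]

theorem laurentMonomial_ne_zero (α : Fin n → ℤ) {z : Fin n → ℂ} (hz : ∀ j, z j ≠ 0) :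
    laurentMonomial α z ≠ 0 :=
  Finset.prod_ne_zero_iff.2 fun j _ => zpow_ne_zero _ (hz j)

theorem differentiableAt_laurentMonomial {α : Fin n → ℤ} {z : Fin n → ℂ}
    (hz : ∀ j, α j < 0 → z j ≠ 0) : DifferentiableAt ℂ (laurentMonomial α) z := by
  unfold laurentMonomial
  have hj : ∀ j, DifferentiableAt ℂ (fun z : Fin n → ℂ => z j ^ α j) z := fun j =>
    (differentiableAt_apply j z).zpow ((lt_or_ge (α j) 0).imp (hz j) id)
  exact (HasFDerivAt.finsetProd fun j _ => (hj j).hasFDerivAt).differentiableAt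

theorem fderiv_eq_zero_of_forall_rot {G : Type*} [NormedAddCommGroup G] [NormedSpace ℂ G]
    {h : (Fin n → ℂ) → G} {z : Fin n → ℂ} (hh : DifferentiableAt ℂ h z) (hz : ∀ j, z j ≠ 0)
    (hrot : ∀ t, h (rot t z) = h z) : fderiv ℂ h z = 0 := by
  suffices hsingle : ∀ j, fderiv ℂ h z (Pi.single j 1) = 0 by
    ext v
    rw [← Finset.univ_sum_single v, map_sum]
    refine Finset.sum_eq_zero fun j _ => ?_
    simpa [← map_smul, ← Pi.single_smul] using congrArg (v j • ·) (hsingle j)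
  intro j
  set γ : ℝ → Fin n → ℂ := fun x => rot (Pi.single j (x : UnitAddCircle)) z
  have hγ0 : γ 0 = z := by simp [γ]
  have hγ : HasDerivAt γ (Pi.single j (2 * Real.pi * Complex.I * z j)) 0 := by
    simp only [γ, rot_single_apply]
    have hcirc := (hasDerivAt_fourier (1 : ℝ) 1 0).mul_const (z j)
    simpa [Function.comp_def, ← Pi.single_smul] using (hasDerivAt_update z j _).scomp (0 : ℝ) hcirc
  have hcomp : HasDerivAt (fun x => h (γ x))
      (fderiv ℂ h z (Pi.single j (2 * Real.pi * Complex.I * z j))) 0 :=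
    (hh.hasFDerivAt.restrictScalars ℝ).comp_hasDerivAt_of_eq 0 hγ hγ0.symm
  have hzero := hcomp.unique ((hasDerivAt_const (0 : ℝ) (h z)).congr_of_eventuallyEq
    (Eventually.of_forall fun x => hrot _))
  rw [← mul_one (_ * z j), ← smul_eq_mul, Pi.single_smul, map_smul] at hzero
  exact (smul_eq_zero.1 hzero).resolve_left (by simp [hz j, Real.pi_ne_zero])

/-- The Fourier coefficients of the restriction of `f` to the torus through `z`, as a function
of `z`. -/
noncomputable def torusCoeff (f : (Fin n → ℂ) → ℂ) (α : Fin n → ℤ) (z : Fin n → ℂ) : ℂ :=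
  mFourierCoeff (fun t => f (rot t z)) α

theorem torusCoeff_eq_integral (f : (Fin n → ℂ) → ℂ) (α : Fin n → ℤ) (z : Fin n → ℂ) :
    torusCoeff f α z = ∫ t, mFourier (-α) t * f (rot t z) ∂torusHaar (Fin n) := rfl

theorem torusCoeff_rot (f : (Fin n → ℂ) → ℂ) (α : Fin n → ℤ) (s : UnitAddTorus (Fin n))
    (z : Fin n → ℂ) : torusCoeff f α (rot s z) = mFourier α s * torusCoeff f α z := by
  simp only [torusCoeff_eq_integral]
  rw [← integral_const_mul, ← integral_add_right_eq_self (μ := torusHaar (Fin n))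
    (fun t => mFourier α s * (mFourier (-α) t * f (rot t z))) s]
  have hinv : mFourier α s * (mFourier (-α) s : ℂ) = 1 := by
    rw [← mFourier_add, add_neg_cancel, mFourier_zero, ContinuousMap.one_apply]
  refine integral_congr_ae (ae_of_all _ fun t => ?_)
  simp only [rot_add, mFourier_apply_add]
  linear_combination (-mFourier (-α) t * f (rot t (rot s z))) * hinv

theorem norm_torusCoeff_le {f : (Fin n → ℂ) → ℂ} {z : Fin n → ℂ} {M : ℝ}
    (hM : ∀ t, ‖f (rot t z)‖ ≤ M) (α : Fin n → ℤ) : ‖torusCoeff f α z‖ ≤ M := by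
  rw [torusCoeff_eq_integral]
  simpa using norm_integral_le_of_norm_le_const (μ := torusHaar (Fin n))
    (ae_of_all _ fun t => by simpa [norm_mFourier_apply] using hM t)

variable {R : Set (Fin n → ℂ)} {f : (Fin n → ℂ) → ℂ}

theorem continuous_comp_rot (hR : IsReinhardt R) (hf : ContinuousOn f R) {z : Fin n → ℂ}
    (hz : z ∈ R) : Continuous fun t => f (rot t z) :=
  hf.comp_continuous (continuous_uncurry_rot.comp (Continuous.prodMk_left z))
    fun t => hR.rot_mem t hz

theorem exists_eventually_forall_norm_comp_rot_le (hRo : IsOpen R) (hR : IsReinhardt R)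
    (hf : ContinuousOn f R) {z : Fin n → ℂ} (hz : z ∈ R) :
    ∃ M : ℝ, ∀ᶠ w in 𝓝 z, ∀ t, ‖f (rot t w)‖ ≤ M := by
  obtain ⟨M, hM⟩ := (isCompact_range (continuous_comp_rot hR hf hz).norm).bddAbove
  refine ⟨M + 1, ?_⟩
  simpa using isCompact_univ.eventually_forall_of_forall_eventually
    (P := fun w t => ‖f (rot t w)‖ ≤ M + 1) fun t _ => by
      have hcont : ContinuousAt (fun q : (Fin n → ℂ) × UnitAddTorus (Fin n) => ‖f (rot q.2 q.1)‖)
          (z, t) :=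
        ((hf.continuousAt (hRo.mem_nhds (hR.rot_mem t hz))).comp
          (f := fun q : (Fin n → ℂ) × UnitAddTorus (Fin n) => rot q.2 q.1)
          (continuous_uncurry_rot.comp continuous_swap).continuousAt).norm
      exact (hcont.eventually_lt continuousAt_const
        ((hM (Set.mem_range_self t)).trans_lt (lt_add_one M))).mono fun q hq => hq.le

theorem differentiableOn_torusCoeff (hRo : IsOpen R) (hR : IsReinhardt R)
    (hf : DifferentiableOn ℂ f R) (α : Fin n → ℤ) : DifferentiableOn ℂ (torusCoeff f α) R := by
  refine differentiableOn_integral (μ := torusHaar (Fin n))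
    (F := fun t z => mFourier (-α) t * f (rot t z)) hRo
    (fun z hz => Continuous.aestronglyMeasurable
      ((map_continuous _).mul (continuous_comp_rot hR hf.continuousOn hz)))
    (fun t => ?_) fun z hz => ?_
  · refine (hf.comp (Differentiable.differentiableOn ?_) fun z => hR.rot_mem t).const_mul _
    unfold rot
    fun_prop
  · simpa [norm_mFourier_apply] using
      exists_eventually_forall_norm_comp_rot_le hRo hR hf.continuousOn hz

theorem eventually_torusCoeff_eq (hRo : IsOpen R) (hR : IsReinhardt R)
    (hf : DifferentiableOn ℂ f R) (α : Fin n → ℤ) {z₀ : Fin n → ℂ} (hz₀ : z₀ ∈ R)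
    (h0 : ∀ j, z₀ j ≠ 0) : ∀ᶠ z in 𝓝 z₀, torusCoeff f α z =
      torusCoeff f α z₀ / laurentMonomial α z₀ * laurentMonomial α z := by
  have hne : ∀ᶠ z : Fin n → ℂ in 𝓝 z₀, ∀ j, z j ≠ 0 :=
    eventually_all.2 fun j => (continuous_apply j).continuousAt.eventually_ne (h0 j)
  obtain ⟨ε, hε, hball⟩ := Metric.eventually_nhds_iff_ball.1 ((hRo.eventually_mem hz₀).and hne)
  set h : (Fin n → ℂ) → ℂ := fun z => torusCoeff f α z / laurentMonomial α z with hh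
  have hdiff : DifferentiableOn ℂ h (Metric.ball z₀ ε) := fun z hz => by
    simp only [hh, div_eq_mul_inv]
    exact (((differentiableOn_torusCoeff hRo hR hf α).differentiableAt
      (hRo.mem_nhds (hball z hz).1)).mul
        ((differentiableAt_laurentMonomial fun j _ => (hball z hz).2 j).inv
          (laurentMonomial_ne_zero α (hball z hz).2))).differentiableWithinAt
  have hrot : ∀ t z, h (rot t z) = h z := fun t z => by
    simp only [hh, torusCoeff_rot, laurentMonomial_rot]
    exact mul_div_mul_left _ _ (norm_ne_zero_iff.1 (by simp [norm_mFourier_apply]))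
  filter_upwards [Metric.ball_mem_nhds z₀ hε] with z hz
  have hconst : h z = h z₀ := Metric.isOpen_ball.is_const_of_fderiv_eq_zero
    (convex_ball z₀ ε).isPreconnected hdiff (fun w hw => fderiv_eq_zero_of_forall_rot
      (hdiff.differentiableAt (Metric.isOpen_ball.mem_nhds hw)) (hball w hw).2 fun t => hrot t w)
    hz (Metric.mem_ball_self hε)
  change _ = h z₀ * _
  rw [← hconst, div_mul_cancel₀ _ (laurentMonomial_ne_zero α (hball z hz).2)]

theorem exists_mem_forall_apply_eq_zero_iff {ι 𝕜 : Type*} [NontriviallyNormedField 𝕜]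
    {U : Set (ι → 𝕜)} (hU : IsOpen U) {z : ι → 𝕜} (hz : z ∈ U) {s : Set ι}
    (hs : ∀ i ∈ s, z i = 0) : ∃ w ∈ U, ∀ i, w i = 0 ↔ i ∈ s := by
  classical
  have hpath : Tendsto (fun (ε : 𝕜) i => if z i = 0 ∧ i ∉ s then ε else z i) (𝓝[≠] 0) (𝓝 z) := by
    refine tendsto_pi_nhds.2 fun i => ?_
    split_ifs with hi
    · rw [hi.1]
      exact tendsto_id.mono_left nhdsWithin_le_nhds
    · exact tendsto_const_nhds
  obtain ⟨ε, hεU, hε⟩ :=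
    ((hpath.eventually (hU.mem_nhds hz)).and eventually_mem_nhdsWithin).exists
  refine ⟨_, hεU, fun i => ?_⟩
  have hε0 : ε ≠ 0 := hε
  grind

theorem laurentMonomial_posPart {z : Fin n → ℂ} (hz : ∀ j, z j ≠ 0) (α : Fin n → ℤ) :
    laurentMonomial α⁺ z = laurentMonomial α z * laurentMonomial α⁻ z := by
  simp only [laurentMonomial, ← Finset.prod_mul_distrib]
  refine Finset.prod_congr rfl fun j _ => ?_
  rw [← zpow_add₀ (hz j), ← Pi.add_apply, ← sub_eq_iff_eq_add.1 (posPart_sub_negPart α)]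

theorem differentiable_laurentMonomial {α : Fin n → ℤ} (hα : 0 ≤ α) :
    Differentiable ℂ (laurentMonomial α) := fun _ =>
  differentiableAt_laurentMonomial fun j hj => absurd hj (hα j).not_gt

theorem differentiableOn_const_mul_laurentMonomial {α : Fin n → ℤ} {a : ℂ}
    (ha : a ≠ 0 → ∀ z ∈ R, ∀ j, α j < 0 → z j ≠ 0) :
    DifferentiableOn ℂ (fun z => a * laurentMonomial α z) R := by
  rcases eq_or_ne a 0 with rfl | h0
  · simp
  · exact fun z hz =>
      ((differentiableAt_laurentMonomial (ha h0 z hz)).const_mul a).differentiableWithinAt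

-- Denominators are cleared because `z ^ α` need not be holomorphic on all of `R`: that the
-- constant on the right vanishes when it is not is a consequence of this identity.
theorem torusCoeff_mul_laurentMonomial_negPart (hRo : IsOpen R) (hRc : IsPreconnected R)
    (hR : IsReinhardt R) (hf : DifferentiableOn ℂ f R) (α : Fin n → ℤ) {z₀ : Fin n → ℂ}
    (hz₀ : z₀ ∈ R) (h0 : ∀ j, z₀ j ≠ 0) {z : Fin n → ℂ} (hz : z ∈ R) :
    torusCoeff f α z * laurentMonomial α⁻ z =
      torusCoeff f α z₀ / laurentMonomial α z₀ * laurentMonomial α⁺ z := by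
  refine sub_eq_zero.1 (eqOn_zero_of_preconnected_of_eventuallyEq_zero (g := fun z =>
    torusCoeff f α z * laurentMonomial α⁻ z -
      torusCoeff f α z₀ / laurentMonomial α z₀ * laurentMonomial α⁺ z) ?_ hRo hRc hz₀ ?_ hz)
  · exact ((differentiableOn_torusCoeff hRo hR hf α).mul
      (differentiable_laurentMonomial (negPart_nonneg α)).differentiableOn).sub
        ((differentiable_laurentMonomial (posPart_nonneg α)).differentiableOn.const_mul _)
  · have hne : ∀ᶠ z : Fin n → ℂ in 𝓝 z₀, ∀ j, z j ≠ 0 :=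
      eventually_all.2 fun j => (continuous_apply j).continuousAt.eventually_ne (h0 j)
    filter_upwards [eventually_torusCoeff_eq hRo hR hf α hz₀ h0, hne] with z hz hz0
    rw [hz, laurentMonomial_posPart hz0, mul_assoc, sub_self]

theorem forall_ne_zero_of_mul_laurentMonomial_negPart_eq (hRo : IsOpen R)
    {α : Fin n → ℤ} {g : (Fin n → ℂ) → ℂ} {a : ℂ} (ha : a ≠ 0)
    (hg : ∀ z ∈ R, g z * laurentMonomial α⁻ z = a * laurentMonomial α⁺ z) :
    ∀ z ∈ R, ∀ j, α j < 0 → z j ≠ 0 := by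
  intro z hz j hj hzj
  obtain ⟨w, hw, hw0⟩ := exists_mem_forall_apply_eq_zero_iff hRo hz (s := {j}) (by simpa using hzj)
  have hneg : laurentMonomial α⁻ w = 0 := by
    refine Finset.prod_eq_zero (Finset.mem_univ j) ?_
    rw [(hw0 j).2 rfl, zero_zpow]
    simpa [negPart_eq_zero] using hj
  have hpos : laurentMonomial α⁺ w ≠ 0 := by
    refine Finset.prod_ne_zero_iff.2 fun i _ => ?_
    rcases eq_or_ne i j with rfl | hij
    · simp [posPart_eq_zero.2 hj.le]
    · exact zpow_ne_zero _ fun h => hij ((hw0 i).1 h)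
  simpa [hneg, ha, hpos] using hg w hw

theorem exists_torusCoeff_eq (hRo : IsOpen R) (hRc : IsConnected R) (hR : IsReinhardt R)
    (hf : DifferentiableOn ℂ f R) :
    ∃ a : (Fin n → ℤ) → ℂ, (∀ α, a α ≠ 0 → ∀ z ∈ R, ∀ j, α j < 0 → z j ≠ 0) ∧
      ∀ α, ∀ z ∈ R, torusCoeff f α z = a α * laurentMonomial α z := by
  obtain ⟨y, hy⟩ := hRc.nonempty
  obtain ⟨z₀, hz₀, h0⟩ := exists_mem_forall_apply_eq_zero_iff hRo hy (s := ∅) (by simp)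
  simp only [Set.mem_empty_iff_false, iff_false] at h0
  set a : (Fin n → ℤ) → ℂ := fun α => torusCoeff f α z₀ / laurentMonomial α z₀
  have ha : ∀ α, a α ≠ 0 → ∀ z ∈ R, ∀ j, α j < 0 → z j ≠ 0 := fun α hα =>
    forall_ne_zero_of_mul_laurentMonomial_negPart_eq hRo hα fun z hz =>
      torusCoeff_mul_laurentMonomial_negPart hRo hRc.isPreconnected hR hf α hz₀ h0 hz
  refine ⟨a, ha, fun α z hz => sub_eq_zero.1 ?_⟩
  refine eqOn_zero_of_preconnected_of_eventuallyEq_zero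
    (g := fun z => torusCoeff f α z - a α * laurentMonomial α z)
    ((differentiableOn_torusCoeff hRo hR hf α).sub
      (differentiableOn_const_mul_laurentMonomial (ha α))) hRo hRc.isPreconnected hz₀ ?_ hz
  filter_upwards [eventually_torusCoeff_eq hRo hR hf α hz₀ h0] with z hz
  rw [hz, sub_self]

theorem summable_prod_apply {ι κ : Type*} [Fintype ι] {u : κ → ℝ} (hu : Summable u)
    (h0 : ∀ m, 0 ≤ u m) : Summable fun α : ι → κ => ∏ j, u (α j) := by
  classical
  refine summable_of_sum_le (c := ∏ _j : ι, ∑' m, u m)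
    (fun α => Finset.prod_nonneg fun j _ => h0 _) fun s => ?_
  set S : ι → Finset κ := fun j => s.image fun α => α j
  calc ∑ α ∈ s, ∏ j, u (α j) ≤ ∑ α ∈ Fintype.piFinset S, ∏ j, u (α j) :=
        Finset.sum_le_sum_of_subset_of_nonneg
          (fun α hα => Fintype.mem_piFinset.2 fun j => Finset.mem_image_of_mem (fun α => α j) hα)
          fun α _ _ => Finset.prod_nonneg fun j _ => h0 _
    _ = ∏ j, ∑ m ∈ S j, u m := (Finset.prod_univ_sum S fun _ m => u m).symm
    _ ≤ _ := Finset.prod_le_prod (fun j _ => Finset.sum_nonneg fun m _ => h0 m)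
        fun j _ => hu.sum_le_tsum _ fun m _ => h0 m

theorem summable_pow_natAbs {r : ℝ} (h0 : 0 ≤ r) (h1 : r < 1) :
    Summable fun m : ℤ => r ^ m.natAbs :=
  .of_nat_of_neg (by simpa using summable_geometric_of_lt_one h0 h1)
    (by simpa using summable_geometric_of_lt_one h0 h1)

open scoped Pointwise in
theorem exists_isCompact_mul_subset {M : Type*} [TopologicalSpace M] [MulOneClass M]
    [ContinuousMul M] [LocallyCompactSpace M] {K U : Set M} (hK : IsCompact K) (hU : IsOpen U)
    (hKU : K ⊆ U) : ∃ V ∈ 𝓝 (1 : M), IsCompact V ∧ V * K ⊆ U := by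
  obtain ⟨V, hV, hVK⟩ := compact_open_separated_mul_left hK hU hKU
  obtain ⟨L, hL, hLV, hLc⟩ := local_compact_nhds hV
  exact ⟨L, hL, hLc, (Set.mul_subset_mul_right hLV).trans hVK⟩

theorem laurentMonomial_mul (α : Fin n → ℤ) (x z : Fin n → ℂ) :
    laurentMonomial α (x * z) = laurentMonomial α x * laurentMonomial α z := by
  simp only [laurentMonomial, Pi.mul_apply, mul_zpow, Finset.prod_mul_distrib]

theorem laurentMonomial_zpow_sign (α : Fin n → ℤ) (x : ℂ) :
    laurentMonomial α (fun j => x ^ (α j).sign) = ∏ j, x ^ (α j).natAbs := by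
  simp only [laurentMonomial, ← zpow_mul, Int.sign_mul_self_eq_natAbs, zpow_natCast]

theorem exists_one_lt_forall_zpow_sign_mem {V : Set (Fin n → ℂ)} (hV : V ∈ 𝓝 1) :
    ∃ r : ℝ, 1 < r ∧ ∀ α : Fin n → ℤ, (fun j => (r : ℂ) ^ (α j).sign) ∈ V := by
  have hlim : ∀ σ : Fin n → SignType,
      Tendsto (fun (r : ℝ) j => (r : ℂ) ^ (σ j : ℤ)) (𝓝[>] 1) (𝓝 1) := fun σ =>
    tendsto_pi_nhds.2 fun j => by
      have hcont : ContinuousAt (fun r : ℝ => (r : ℂ) ^ (σ j : ℤ)) 1 :=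
        Complex.continuous_ofReal.continuousAt.zpow₀ _ (by simp)
      simpa using hcont.tendsto.mono_left nhdsWithin_le_nhds
  obtain ⟨r, hrV, hr⟩ := ((eventually_all.2 fun σ => (hlim σ).eventually hV).and
    eventually_mem_nhdsWithin).exists
  refine ⟨r, hr, fun α => ?_⟩
  simp only [Int.sign_eq_sign]
  exact hrV fun j => SignType.sign (α j)

theorem exists_norm_torusCoeff_le (hR : IsReinhardt R) (hf : ContinuousOn f R)
    {K : Set (Fin n → ℂ)} (hK : IsCompact K) (hKR : K ⊆ R) :
    ∃ M : ℝ, ∀ α, ∀ z ∈ K, ‖torusCoeff f α z‖ ≤ M := by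
  obtain ⟨M, hM⟩ := (isCompact_univ.prod hK).exists_bound_of_continuousOn
    (hf.comp (continuous_uncurry_rot (n := n)).continuousOn fun q hq => hR.rot_mem q.1 (hKR hq.2))
  exact ⟨M, fun α z hz => norm_torusCoeff_le (fun t => hM (t, z) ⟨Set.mem_univ t, hz⟩) α⟩

open scoped Pointwise in
theorem exists_summable_norm_mul_laurentMonomial_le (hRo : IsOpen R) (hR : IsReinhardt R)
    (hf : ContinuousOn f R) {a : (Fin n → ℤ) → ℂ}
    (ha : ∀ α, ∀ z ∈ R, torusCoeff f α z = a α * laurentMonomial α z)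
    {K : Set (Fin n → ℂ)} (hK : IsCompact K) (hKR : K ⊆ R) :
    ∃ u : (Fin n → ℤ) → ℝ, Summable u ∧ ∀ α, ∀ z ∈ K, ‖a α * laurentMonomial α z‖ ≤ u α := by
  obtain ⟨V, hV, hVc, hVK⟩ := exists_isCompact_mul_subset hK hRo hKR
  obtain ⟨r, hr, hrV⟩ := exists_one_lt_forall_zpow_sign_mem hV
  obtain ⟨M, hM⟩ := exists_norm_torusCoeff_le hR hf (hVc.mul hK) hVK
  have hr0 : 0 < r := zero_lt_one.trans hr
  refine ⟨fun α => (∏ j, r⁻¹ ^ (α j).natAbs) * M, (summable_prod_apply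
    (summable_pow_natAbs (inv_nonneg.2 hr0.le) (inv_lt_one_of_one_lt₀ hr))
    fun m => by positivity).mul_right M, fun α z hz => ?_⟩
  have hmem := Set.mul_mem_mul (hrV α) hz
  have hscale : a α * laurentMonomial α z = (∏ j, (r : ℂ)⁻¹ ^ (α j).natAbs) *
      torusCoeff f α ((fun j => (r : ℂ) ^ (α j).sign) * z) := by
    have hone : (∏ j, (r : ℂ)⁻¹ ^ (α j).natAbs) * ∏ j, (r : ℂ) ^ (α j).natAbs = 1 := by
      rw [← Finset.prod_mul_distrib]
      exact Finset.prod_eq_one fun j _ => by simp [hr0.ne']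
    rw [ha α _ (hVK hmem), laurentMonomial_mul, laurentMonomial_zpow_sign]
    linear_combination (-(a α * laurentMonomial α z)) * hone
  rw [hscale, norm_mul, norm_prod]
  simp only [norm_pow, norm_inv, Complex.norm_real, Real.norm_of_nonneg hr0.le]
  exact mul_le_mul_of_nonneg_left (hM α _ hmem) (by positivity)

theorem continuous_eLpNorm_coe {X E : Type*} [TopologicalSpace X] [CompactSpace X]
    [MeasurableSpace X] [BorelSpace X] [NormedAddCommGroup E] [NormedSpace ℝ E]
    [SecondCountableTopologyEither X E] (μ : Measure X) [IsFiniteMeasure μ] {p : ℝ≥0∞}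
    (hp : 1 ≤ p) : Continuous fun F : C(X, E) => eLpNorm F p μ := by
  have : Fact (1 ≤ p) := ⟨hp⟩
  have henorm : ∀ F : C(X, E), ‖ContinuousMap.toLp p μ ℝ F‖ₑ = eLpNorm F p μ := fun F => by
    rw [Lp.enorm_def, eLpNorm_congr_ae (ContinuousMap.coeFn_toLp μ F)]
  simpa only [henorm] using (ContinuousMap.toLp (E := E) p μ ℝ).continuous.enorm

theorem mFourierCoeff_eq_of_hasSum {d : Type*} [Fintype d] {c : (d → ℤ) → ℂ}
    {F : C(UnitAddTorus d, ℂ)} (h : HasSum (fun α => c α • mFourier α) F) (α : d → ℤ) :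
    mFourierCoeff F α = c α := by
  let e : C(UnitAddTorus d, ℂ) →L[ℂ] Lp ℂ 2 (torusHaar d) := ContinuousMap.toLp 2 (torusHaar d) ℂ
  have hinner : ∀ G, inner ℂ (e (mFourier α)) (e G) = mFourierCoeff G α := fun G => by
    rw [ContinuousMap.inner_toLp]
    simp only [mFourierCoeff, mFourier_neg, smul_eq_mul, mul_comm]
    rfl
  have horth : ∀ β, inner ℂ (e (mFourier α)) (e (mFourier β)) = if α = β then 1 else 0 :=
    orthonormal_iff_ite.1 orthonormal_mFourier α
  have hsum := (h.mapL e).mapL (innerSL ℂ (e (mFourier α)))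
  simp only [map_smul, innerSL_apply_apply, hinner F, horth, smul_eq_mul, mul_ite, mul_one,
    mul_zero] at hsum
  simpa using hsum.unique (hasSum_single α fun β hβ => if_neg hβ.symm)

theorem tendsto_squareIndices : Tendsto (squareIndices n) atTop atTop := by
  refine tendsto_atTop_finset_of_monotone (fun M N hMN α => ?_) fun α => ?_
  · simp only [mem_squareIndices]
    exact fun hα j => (hα j).trans (by exact_mod_cast hMN)
  · refine ⟨∑ j, (α j).natAbs, mem_squareIndices.2 fun j => ?_⟩
    rw [Int.abs_eq_natAbs]
    exact_mod_cast Finset.single_le_sum (f := fun j => (α j).natAbs) (fun i _ => Nat.zero_le _)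
      (Finset.mem_univ j)

theorem filter_squareIndices {M N : ℕ} (h : N ≤ M)
    {_ : DecidablePred fun α : Fin n → ℤ => ∀ j, |α j| ≤ (N : ℤ)} :
    (squareIndices n M).filter (fun α => ∀ j, |α j| ≤ (N : ℤ)) = squareIndices n N := by
  ext α
  simp only [Finset.mem_filter, mem_squareIndices, and_iff_right_iff_imp]
  exact fun hα j => (hα j).trans (by exact_mod_cast h)

theorem exists_eLpNorm_sum_squareIndices_le {p : ℝ≥0∞} (hp1 : 1 < p) (hp : p ≠ ∞) (n : ℕ) :
    ∃ C ≠ ∞, ∀ (c : (Fin n → ℤ) → ℂ) (F : C(UnitAddTorus (Fin n), ℂ)),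
      HasSum (fun α => c α • mFourier α) F → ∀ N,
        eLpNorm (fun t => ∑ α ∈ squareIndices n N, c α * mFourier α t) p (torusHaar (Fin n)) ≤
          C * eLpNorm F p (torusHaar (Fin n)) := by
  obtain ⟨C, hC, h⟩ := exists_eLpNorm_sum_mFourier_filter_abs_le (d := Fin n) hp1 hp
  refine ⟨C, hC, fun c F hF N => ?_⟩
  have hlim := ((continuous_eLpNorm_coe (torusHaar (Fin n)) hp1.le).tendsto F).comp
    (Tendsto.comp hF tendsto_squareIndices)
  refine ge_of_tendsto (ENNReal.Tendsto.const_mul hlim (.inr hC)) ?_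
  filter_upwards [eventually_ge_atTop N] with M hM
  have hM' := h (squareIndices n M) c N
  rw [filter_squareIndices hM] at hM'
  simpa [Function.comp_def, Finset.sum_fn] using hM'

theorem isLaurentExpansion_of_torusCoeff_eq (hRo : IsOpen R) (hR : IsReinhardt R)
    (hf : ContinuousOn f R) {a : (Fin n → ℤ) → ℂ}
    (ha : ∀ α, a α ≠ 0 → ∀ z ∈ R, ∀ j, α j < 0 → z j ≠ 0)
    (hcoeff : ∀ α, ∀ z ∈ R, torusCoeff f α z = a α * laurentMonomial α z) :
    IsLaurentExpansion R f a := by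
  refine ⟨ha, fun K hKR hK => ?_⟩
  obtain ⟨u, hu, hbound⟩ := exists_summable_norm_mul_laurentMonomial_le hRo hR hf hcoeff hK hKR
  refine (HasSumUniformlyOn.of_norm_le_summable hu hbound).congr_right fun z hz => ?_
  let F : C(UnitAddTorus (Fin n), ℂ) := ⟨fun t => f (rot t z), continuous_comp_rot hR hf (hKR hz)⟩
  have hF : ∀ α, mFourierCoeff F α = a α * laurentMonomial α z := fun α => hcoeff α z (hKR hz)
  have hsum := hasSum_mFourier_series_apply_of_summable (f := F)
    (.of_norm_bounded hu fun α => by simpa only [hF] using hbound α z hz) 0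
  simp only [hF] at hsum
  simpa [F, mFourier] using hsum.tsum_eq

theorem IsLaurentExpansion.hasSum_comp_rot {a : (Fin n → ℤ) → ℂ} (ha : IsLaurentExpansion R f a)
    (hR : IsReinhardt R) (hf : ContinuousOn f R) {z : Fin n → ℂ} (hz : z ∈ R) :
    HasSum (fun α => (a α * laurentMonomial α z) • mFourier α)
      (⟨fun t => f (rot t z), continuous_comp_rot hR hf hz⟩ : C(UnitAddTorus (Fin n), ℂ)) := by
  have horbit := ha.hasSum (Set.range fun t => rot t z)
    (Set.range_subset_iff.2 fun t => hR.rot_mem t hz)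
    (isCompact_range (continuous_uncurry_rot.comp (Continuous.prodMk_left z)))
  rw [hasSumUniformlyOn_iff_tendstoUniformlyOn] at horbit
  have hcomp := horbit.comp fun t => rot t z
  rw [Set.preimage_range, tendstoUniformlyOn_univ] at hcomp
  have hcoe : ∀ s : Finset (Fin n → ℤ), (fun t => ∑ α ∈ s, a α * laurentMonomial α (rot t z)) =
      ⇑(∑ α ∈ s, (a α * laurentMonomial α z) • mFourier α) := fun s => by
    ext t
    simp [laurentMonomial_rot, mul_assoc, mul_comm (mFourier _ t)]
  simp only [Function.comp_def, hcoe] at hcomp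
  exact ContinuousMap.tendsto_iff_tendstoUniformly.2 hcomp

theorem existsUnique_isLaurentExpansion (hRo : IsOpen R) (hRc : IsConnected R)
    (hR : IsReinhardt R) (hf : DifferentiableOn ℂ f R) : ∃! a, IsLaurentExpansion R f a := by
  obtain ⟨a, ha, hcoeff⟩ := exists_torusCoeff_eq hRo hRc hR hf
  refine ⟨a, isLaurentExpansion_of_torusCoeff_eq hRo hR hf.continuousOn ha hcoeff,
    fun b hb => funext fun α => ?_⟩
  obtain ⟨y, hy⟩ := hRc.nonempty
  obtain ⟨z, hz, h0⟩ := exists_mem_forall_apply_eq_zero_iff hRo hy (s := ∅) (by simp)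
  refine mul_right_cancel₀ (laurentMonomial_ne_zero α fun j => by simpa using h0 j) ?_
  rw [← hcoeff α z hz]
  exact (mFourierCoeff_eq_of_hasSum (hb.hasSum_comp_rot hR hf.continuousOn hz) α).symm

theorem squarePartialSum_rot (a : (Fin n → ℤ) → ℂ) (N : ℕ) (z : Fin n → ℂ)
    (t : UnitAddTorus (Fin n)) : squarePartialSum a N (rot t z) =
      ∑ α ∈ squareIndices n N, a α * laurentMonomial α z * mFourier α t := by
  simp only [squarePartialSum, laurentMonomial_rot]
  exact Finset.sum_congr rfl fun α _ => by ring

theorem exists_eLpNorm_squarePartialSum_rot_le {p : ℝ≥0∞} (hp1 : 1 < p) (hp : p ≠ ∞)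
    (hR : IsReinhardt R) (hf : ContinuousOn f R) {a : (Fin n → ℤ) → ℂ}
    (ha : IsLaurentExpansion R f a) : ∃ C ≠ ∞, ∀ z ∈ R, ∀ N,
      eLpNorm (fun t => squarePartialSum a N (rot t z)) p (torusHaar (Fin n)) ≤
        C * eLpNorm (fun t => f (rot t z)) p (torusHaar (Fin n)) := by
  obtain ⟨C, hC, h⟩ := exists_eLpNorm_sum_squareIndices_le hp1 hp n
  refine ⟨C, hC, fun z hz N => ?_⟩
  simp only [squarePartialSum_rot]
  exact h _ _ (ha.hasSum_comp_rot hR hf hz) N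

theorem tendsto_eLpNorm_squarePartialSum_rot_sub {p : ℝ≥0∞} (hp : 1 ≤ p)
    (hR : IsReinhardt R) (hf : ContinuousOn f R) {a : (Fin n → ℤ) → ℂ}
    (ha : IsLaurentExpansion R f a) {z : Fin n → ℂ} (hz : z ∈ R) :
    Tendsto (fun N => eLpNorm (fun t => squarePartialSum a N (rot t z) - f (rot t z)) p
      (torusHaar (Fin n))) atTop (𝓝 0) := by
  have hsum := Tendsto.comp (ha.hasSum_comp_rot hR hf hz) tendsto_squareIndices
  have hlim := ((continuous_eLpNorm_coe (torusHaar (Fin n)) hp).tendsto _).comp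
    (tendsto_sub_nhds_zero_iff.2 hsum)
  simpa [Function.comp_def, Pi.sub_def, squarePartialSum_rot] using hlim

theorem measurePreserving_rot (t : UnitAddTorus (Fin n)) :
    MeasurePreserving (rot t) (volume : Measure (Fin n → ℂ)) volume :=
  volume_preserving_pi (f := fun j z => fourier 1 (t j) * z) fun j => by
    rw [fourier_one]
    exact (rotation (toCircle (t j))).measurePreserving

theorem IsReinhardt.measurePreserving_uncurry_rot (hR : IsReinhardt R) (hRm : MeasurableSet R) :
    MeasurePreserving (Function.uncurry rot) ((torusHaar (Fin n)).prod (volume.restrict R))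
      (volume.restrict R) :=
  measurePreserving_uncurry continuous_uncurry_rot.measurable fun t => by
    simpa only [hR.rot_preimage] using (measurePreserving_rot t).restrict_preimage hRm

theorem IsLaurentExpansion.differentiableOn_squarePartialSum {a : (Fin n → ℤ) → ℂ}
    (ha : IsLaurentExpansion R f a) (N : ℕ) : DifferentiableOn ℂ (squarePartialSum a N) R :=
  .fun_sum fun α _ => differentiableOn_const_mul_laurentMonomial (ha.wellDefined α)

theorem IsLaurentExpansion.memBergman_squarePartialSum {p : ℝ≥0∞} (hp1 : 1 < p) (hp : p ≠ ∞)
    (hRo : IsOpen R) (hR : IsReinhardt R) (hf : MemBergman R p f) {a : (Fin n → ℤ) → ℂ}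
    (ha : IsLaurentExpansion R f a) (N : ℕ) : MemBergman R p (squarePartialSum a N) := by
  obtain ⟨C, hC, hbound⟩ :=
    exists_eLpNorm_squarePartialSum_rot_le hp1 hp hR hf.holomorphic.continuousOn ha
  have hhol := ha.differentiableOn_squarePartialSum N
  have hmeas := hhol.continuousOn.aestronglyMeasurable (μ := volume) hRo.measurableSet
  refine ⟨hhol, hmeas, ?_⟩
  exact (eLpNorm_le_mul_of_ae_orbit (hR.measurePreserving_uncurry_rot hRo.measurableSet)
    (zero_lt_one.trans hp1).ne' hp hmeas hf.memLp.1 (ae_restrict_of_forall_mem hRo.measurableSet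
      fun z hz => hbound z hz N)).trans_lt (ENNReal.mul_lt_top hC.lt_top hf.memLp.2)

theorem IsLaurentExpansion.tendsto_eLpNorm_squarePartialSum_sub {p : ℝ≥0∞} (hp1 : 1 < p)
    (hp : p ≠ ∞) (hRo : IsOpen R) (hR : IsReinhardt R) (hf : MemBergman R p f)
    {a : (Fin n → ℤ) → ℂ} (ha : IsLaurentExpansion R f a) :
    Tendsto (fun N => eLpNorm (fun z => squarePartialSum a N z - f z) p (volume.restrict R))
      atTop (𝓝 0) := by
  have hfc := hf.holomorphic.continuousOn
  obtain ⟨C, hC, hbound⟩ := exists_eLpNorm_squarePartialSum_rot_le hp1 hp hR hfc ha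
  refine tendsto_eLpNorm_zero_of_ae_orbit (C := C + 1)
    (hR.measurePreserving_uncurry_rot hRo.measurableSet) (zero_lt_one.trans hp1).ne' hp
    (fun N => ((ha.differentiableOn_squarePartialSum N).sub
      hf.holomorphic).continuousOn.aestronglyMeasurable hRo.measurableSet) hf.memLp (by finiteness)
    (fun N => ae_restrict_of_forall_mem hRo.measurableSet fun z hz => ?_)
    (ae_restrict_of_forall_mem hRo.measurableSet fun z hz =>
      tendsto_eLpNorm_squarePartialSum_rot_sub hp1.le hR hfc ha hz)
  rw [add_mul, one_mul]
  exact (eLpNorm_sub_le (continuous_comp_rot hR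
    (ha.differentiableOn_squarePartialSum N).continuousOn hz).aestronglyMeasurable
      (continuous_comp_rot hR hfc hz).aestronglyMeasurable hp1.le).trans
        (add_le_add_left (hbound z hz N) _)

end ReinhardtLaurent

open ReinhardtLaurent in
theorem mainTheorem1_general {n : ℕ} (R : Set (Fin n → ℂ)) (hRo : IsOpen R) (hRc : IsConnected R)
    (hR : IsReinhardt R) (p : ℝ≥0∞) (hp1 : 1 < p) (hp : p < ∞) (f : (Fin n → ℂ) → ℂ)
    (hf : MemBergman R p f) :
    ∃ a : (Fin n → ℤ) → ℂ,
      IsLaurentExpansion R f a ∧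
      (∀ b : (Fin n → ℤ) → ℂ, IsLaurentExpansion R f b → b = a) ∧
      (∀ N : ℕ, MemBergman R p (squarePartialSum a N)) ∧
      Tendsto (fun N : ℕ => eLpNorm (fun z => squarePartialSum a N z - f z) p (volume.restrict R))
        atTop (𝓝 0) := by
  obtain ⟨a, ha, huniq⟩ := existsUnique_isLaurentExpansion hRo hRc hR hf.holomorphic
  exact ⟨a, ha, huniq, ha.memBergman_squarePartialSum hp1 hp.ne hRo hR hf,
    ha.tendsto_eLpNorm_squarePartialSum_sub hp1 hp.ne hRo hR hf⟩

theorem mainTheorem1 {n : ℕ} (R : Set (Fin n → ℂ))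
    (hR : ReinhardtLaurent.IsBoundedReinhardtDomain R)
    (p : ℝ≥0∞) (hp1 : 1 < p) (hp : p < ∞)
    (f : (Fin n → ℂ) → ℂ) (hf : ReinhardtLaurent.MemBergman R p f) :
    ∃ a : (Fin n → ℤ) → ℂ,
      ReinhardtLaurent.IsLaurentExpansion R f a ∧
      (∀ b : (Fin n → ℤ) → ℂ, ReinhardtLaurent.IsLaurentExpansion R f b → b = a) ∧
      (∀ N : ℕ, ReinhardtLaurent.MemBergman R p (ReinhardtLaurent.squarePartialSum a N)) ∧
      Tendsto
        (fun N : ℕ =>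
          eLpNorm (fun z => ReinhardtLaurent.squarePartialSum a N z - f z) p (volume.restrict R))
        atTop (𝓝 0) :=
  mainTheorem1_general R hR.isOpen hR.isConnected hR.isReinhardt p hp1 hp f hf
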